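/- Let $p$ be a prime, $k$ an algebraically closed field of characteristic $p$, and $G$ a finite group. Let $B$ be a $p$-block of $G$, that is, a block of the group algebra $kG$, with defect group $D$. Let $\operatorname{Irr}_p(B)$ be the set of irreducible Brauer characters belonging to $B$ (the complex-valued functions on the $p$-regular elements of $G$ that are the Brauer characters of the simple $kG$-modules in $B$, with respect to a fixed embedding into $\mathbb{C}^\times$ of the group of $|G|_{p'}$-th roots of unity of $k$), let $l(B)=|\operatorname{Irr}_p(B)|$, let $\dim B$ be the dimension of $B$ over $k$, and let $C=(c_{\varphi\psi})_{\varphi,\psi\in\operatorname{Irr}_p(B)}$ be the Cartan matrix of $B$, where $c_{\varphi\psi}$ is the multiplicity of the simple module with Brauer character $\varphi$ as a composition factor of the principal indecomposable module whose simple head has Brauer character $\psi$. Then the following hold. (a) We have $$\frac{\dim B}{\operatorname{tr} C}\le\sum_{\varphi\in\operatorname{Irr}_p(B)}\varphi(1)^2,$$ with equality if and only if $l(B)=1$. (b) If $\operatorname{tr} C\le l(B)|D|$, then $$\frac{\dim B}{l(B)|D|}\le\sum_{\varphi\in\operatorname{Irr}_p(B)}\varphi(1)^2,$$ with equality if and only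 if $l(B)=1$. -/

import Mathlib

open scoped ComplexOrder

noncomputable section

namespace ModRep

universe u v w

/-! ### Modules over a ring: composition multiplicities and principal indecomposable modules -/

/-- The multiplicity of the simple module `S` as a composition factor of the module `M` of finite
length: the number of factors isomorphic to `S` in a composition series `⊥ = s 0 < ⋯ < s n = ⊤`
of `M` (by the Jordan-Hölder theorem the choice of the series does not matter). -/
def compositionMultiplicity (R : Type u) (M : Type v) (S : Type w) [Ring R]
    [AddCommGroup M] [Module R M] [IsNoetherian R M] [IsArtinian R M]
    [AddCommGroup S] [Module R S] : ℕ :=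
  let s := (exists_compositionSeries_of_isNoetherian_isArtinian R M).choose
  Nat.card {i : Fin s.length //
    Nonempty ((↥(s i.succ) ⧸ (s i.castSucc).submoduleOf (s i.succ)) ≃ₗ[R] S)}

/-- `e` is a primitive idempotent of the ring `R`: a nonzero idempotent that is not the sum of two
nonzero orthogonal idempotents. -/
structure IsPrimitiveIdempotent {R : Type u} [Ring R] (e : R) : Prop where
  idem : IsIdempotentElem e
  ne_zero : e ≠ 0
  indecomposable : ∀ a b : R, IsIdempotentElem a → IsIdempotentElem b → a * b = 0 → b * a = 0 →
    e = a + b → a = 0 ∨ b = 0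

/-- `e` is a block idempotent of the ring `R`: a primitive idempotent of the center of `R`. -/
structure IsBlockIdempotent {R : Type u} [Ring R] (e : R) : Prop where
  idem : IsIdempotentElem e
  central : e ∈ Set.center R
  ne_zero : e ≠ 0
  indecomposable : ∀ a b : R, a ∈ Set.center R → b ∈ Set.center R →
    IsIdempotentElem a → IsIdempotentElem b → a * b = 0 → e = a + b → a = 0 ∨ b = 0

/-- `P` is a principal indecomposable module of `R` with head `S`: it is a left ideal generated
by a primitive idempotent, and the simple module `S` is a quotient of it. Over an artinian ring
this makes `P` the projective cover of `S`. -/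
def IsPrincipalIndecomposable {R : Type u} [Ring R] (P : Submodule R R) (S : Type v)
    [AddCommGroup S] [Module R S] : Prop :=
  (∃ e : R, IsPrimitiveIdempotent e ∧ P = Submodule.span R {e}) ∧
    ∃ f : P →ₗ[R] S, Function.Surjective f

/-- Over a left artinian ring every simple module is the head of a principal indecomposable
module. -/
theorem exists_isPrincipalIndecomposable {R : Type u} [Ring R] [IsArtinianRing R] (S : Type v)
    [AddCommGroup S] [Module R S] [IsSimpleModule R S] :
    ∃ P : Submodule R R, IsPrincipalIndecomposable P S := by
  have key : ∀ P : Submodule R R, (∃ e : R, IsIdempotentElem e ∧ (∃ s : S, e • s ≠ 0) ∧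
      P = Submodule.span R {e}) → ∃ e : R, IsPrimitiveIdempotent e ∧ ∃ s : S, e • s ≠ 0 := by
    intro P
    induction P using WellFoundedLT.induction with
    | ind P ih =>
      rintro ⟨e, he, ⟨s, hs⟩, rfl⟩
      by_cases hp : IsPrimitiveIdempotent e
      · exact ⟨e, hp, s, hs⟩
      have h0 : e ≠ 0 := by rintro rfl; simp at hs
      have hnot : ∃ a b : R, IsIdempotentElem a ∧ IsIdempotentElem b ∧ a * b = 0 ∧ b * a = 0 ∧
          e = a + b ∧ a ≠ 0 ∧ b ≠ 0 := by
        by_contra hcon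
        push Not at hcon
        refine hp ⟨he, h0, fun a b ha hb h1 h2 h3 => ?_⟩
        by_cases ha0 : a = 0
        · exact Or.inl ha0
        · exact Or.inr (hcon a b ha hb h1 h2 h3 ha0)
      obtain ⟨a, b, ha, hb, hab, hba, rfl, ha0, hb0⟩ := hnot
      have lt : ∀ x y : R, IsIdempotentElem x → IsIdempotentElem y → x * y = 0 → y * x = 0 →
          y ≠ 0 → Submodule.span R {x} < Submodule.span R {x + y} := by
        intro x y hx hy hxy hyx hy0
        refine lt_of_le_of_ne ?_ fun h => hy0 ?_
        · rw [Submodule.span_singleton_le_iff_mem, Submodule.mem_span_singleton]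
          exact ⟨x, by rw [smul_eq_mul, mul_add, hx.eq, hxy, add_zero]⟩
        · have : y ∈ Submodule.span R {x} := by
            rw [h, Submodule.mem_span_singleton]
            exact ⟨y, by rw [smul_eq_mul, mul_add, hy.eq, hyx, zero_add]⟩
          obtain ⟨r, hr⟩ := Submodule.mem_span_singleton.1 this
          rw [smul_eq_mul] at hr
          rw [← hy.eq]
          nth_rewrite 1 [← hr]
          rw [mul_assoc, hxy, mul_zero]
      by_cases has : a • s = 0
      · have hbs : b • s ≠ 0 := by
          intro hbs
          exact hs (by rw [add_smul, has, hbs, add_zero])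
        refine ih _ ?_ ⟨b, hb, ⟨s, hbs⟩, rfl⟩
        rw [add_comm]
        exact lt b a hb ha hba hab ha0
      · exact ih _ (lt a b ha hb hab hba hb0) ⟨a, ha, ⟨s, has⟩, rfl⟩
  have hne : ∃ s : S, (1 : R) • s ≠ 0 := by
    have := IsSimpleModule.nontrivial R S
    obtain ⟨s, hs⟩ := exists_ne (0 : S)
    exact ⟨s, by simpa using hs⟩
  obtain ⟨e, he, s, hs⟩ := key _ ⟨1, IsIdempotentElem.one, hne, rfl⟩
  refine ⟨Submodule.span R {e}, ⟨e, he, rfl⟩,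
    (LinearMap.toSpanSingleton R S (e • s)).domRestrict _, ?_⟩
  refine LinearMap.surjective_of_ne_zero fun h => hs ?_
  have h1 := LinearMap.congr_fun h ⟨e, Submodule.mem_span_singleton_self e⟩
  simpa [smul_smul, he.idem.eq] using h1

/-! ### Blocks of a group algebra and their defect groups -/

/-- A block of the group algebra of `G` over `k`, given by its block idempotent. -/
structure Block (k : Type u) (G : Type v) [Field k] [Group G] where
  idem : MonoidAlgebra k G
  isBlockIdempotent : IsBlockIdempotent idem

/-- The block as a direct summand (a two-sided ideal) of the group algebra. -/
def Block.ideal {k : Type u} {G : Type v} [Field k] [Group G] (B : Block k G) :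
    Submodule k (MonoidAlgebra k G) :=
  LinearMap.range (LinearMap.mulLeft k B.idem)

/-- `dim B`, the dimension of the block as a vector space over `k`. -/
def Block.dim {k : Type u} {G : Type v} [Field k] [Group G] (B : Block k G) : ℕ :=
  Module.finrank k B.ideal

/-- The module `V` belongs to the block `B`. -/
def Block.Contains {k : Type u} {G : Type v} [Field k] [Group G] (B : Block k G)
    (V : Type w) [AddCommGroup V] [Module (MonoidAlgebra k G) V] : Prop :=
  ∀ x : V, B.idem • x = x

/-- The relative trace `∑ g a g⁻¹` of `a`, with `g` running over representatives of the left
cosets of `D` in `G`. It does not depend on the representatives if `a` commutes with `D`. -/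
def relativeTrace {k : Type u} {G : Type v} [Field k] [Group G] (D : Subgroup G)
    (a : MonoidAlgebra k G) : MonoidAlgebra k G :=
  ∑ᶠ x : G ⧸ D, MonoidAlgebra.of k G x.out * a * MonoidAlgebra.of k G x.out⁻¹

/-- `D` is a defect group of `B`: a subgroup that is minimal among the subgroups `Q` of `G` such
that the block idempotent is the relative trace from `Q` to `G` of an element of the group
algebra that is fixed under conjugation by `Q`. -/
def Block.IsDefectGroup {k : Type u} {G : Type v} [Field k] [Group G] (B : Block k G)
    (D : Subgroup G) : Prop :=
  Minimal (fun Q : Subgroup G => ∃ a : MonoidAlgebra k G,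
    (∀ q ∈ Q, MonoidAlgebra.of k G q * a = a * MonoidAlgebra.of k G q) ∧
      relativeTrace Q a = B.idem) D

/-! ### Brauer characters -/

/-- The `p`-regular elements of `G`: those of order prime to `p`. -/
abbrev PRegular (p : ℕ) (G : Type v) [Group G] : Type v := {g : G // ¬ p ∣ orderOf g}

instance (p : ℕ) [hp : Fact p.Prime] (G : Type v) [Group G] : One (PRegular p G) :=
  ⟨⟨1, by rw [orderOf_one]; exact hp.out.not_dvd_one⟩⟩

/-- Homomorphisms to `ℂ` from the group of `m`-th roots of unity of `k`, where `m` is the part of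
`|G|` prime to `p`. -/
abbrev RootLift (p : ℕ) (k : Type u) (G : Type v) [Field k] : Type u :=
  rootsOfUnity (ordCompl[p] (Nat.card G)) k →* ℂˣ

/-- The homomorphism `θ` on roots of unity, as a function from `k` to `ℂ` (with value `0` at the
other elements of `k`). -/
def RootLift.lift {p : ℕ} {k : Type u} {G : Type v} [Field k] (θ : RootLift p k G) : k → ℂ :=
  Function.extend (fun ζ : rootsOfUnity (ordCompl[p] (Nat.card G)) k => ((ζ : kˣ) : k))
    (fun ζ => ((θ ζ : ℂˣ) : ℂ)) 0

/-- The Brauer character of the module `V`: at a `p`-regular element `g` it is the sum of the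
complex lifts of the eigenvalues, with multiplicities, of the action of `g` on `V`. -/
def brauerCharacter {p : ℕ} {k : Type u} {G : Type v} [Field k] [Group G] (θ : RootLift p k G)
    (V : Type w) [AddCommGroup V] [Module k V] [Module (MonoidAlgebra k G) V]
    [IsScalarTower k (MonoidAlgebra k G) V] [Module.Finite k V] : PRegular p G → ℂ :=
  fun g => ((Algebra.lsmul k k V (MonoidAlgebra.of k G g)).charpoly.roots.map θ.lift).sum

/-- Isomorphic modules have the same Brauer character. -/
theorem brauerCharacter_congr {p : ℕ} {k : Type u} {G : Type v} [Field k] [Group G]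
    (θ : RootLift p k G) {V W : Type*} [AddCommGroup V] [Module k V]
    [Module (MonoidAlgebra k G) V] [IsScalarTower k (MonoidAlgebra k G) V] [Module.Finite k V]
    [AddCommGroup W] [Module k W] [Module (MonoidAlgebra k G) W]
    [IsScalarTower k (MonoidAlgebra k G) W] [Module.Finite k W]
    (e : V ≃ₗ[MonoidAlgebra k G] W) : brauerCharacter θ V = brauerCharacter θ W := by
  funext g
  have h : Algebra.lsmul k k W (MonoidAlgebra.of k G g) =
      (e.restrictScalars k).conj (Algebra.lsmul k k V (MonoidAlgebra.of k G g)) := by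
    ext x
    simp [LinearEquiv.conj_apply]
  unfold brauerCharacter
  rw [h, LinearEquiv.charpoly_conj]

section Irr

variable {p : ℕ} {k : Type u} {G : Type v} [Field k] [Group G] [Finite G]

instance : IsArtinianRing (MonoidAlgebra k G) := IsArtinianRing.of_finite k _

/-- `Irr_p(B)`, the set of irreducible Brauer characters belonging to the block `B`: the Brauer
characters of the simple modules in `B`. (Every simple module over the group algebra is isomorphic
to a quotient of the regular module.) -/
def Block.Irr (B : Block k G) (θ : RootLift p k G) : Set (PRegular p G → ℂ) :=
  {φ | ∃ I : Submodule (MonoidAlgebra k G) (MonoidAlgebra k G),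
    IsSimpleModule (MonoidAlgebra k G) (MonoidAlgebra k G ⧸ I) ∧
    B.Contains (MonoidAlgebra k G ⧸ I) ∧
    brauerCharacter θ (MonoidAlgebra k G ⧸ I) = φ}

/-- Every simple module is a factor in every composition series of the regular module. -/
theorem exists_factor_equiv {R : Type u} [Ring R] {S : Type v} [AddCommGroup S] [Module R S]
    [IsSimpleModule R S] (s : CompositionSeries (Submodule R R)) (h0 : s.head = ⊥)
    (h1 : s.last = ⊤) : ∃ i : Fin s.length,
      Nonempty ((↥(s i.succ) ⧸ (s i.castSucc).submoduleOf (s i.succ)) ≃ₗ[R] S) := by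
  have := IsSimpleModule.nontrivial R S
  obtain ⟨x, hx⟩ := exists_ne (0 : S)
  let f : R →ₗ[R] S := LinearMap.toSpanSingleton R S x
  have hex : ∃ i : Fin s.length, s i.castSucc ≤ LinearMap.ker f ∧
      ¬ s i.succ ≤ LinearMap.ker f := by
    by_contra hcon
    push Not at hcon
    have hall : ∀ i, s i ≤ LinearMap.ker f := by
      intro i
      induction i using Fin.induction with
      | zero => exact le_trans (le_of_eq h0) bot_le
      | succ i ih => exact hcon i ih
    have htop : (⊤ : Submodule R R) ≤ LinearMap.ker f := h1 ▸ hall (Fin.last _)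
    have h2 : f 1 = 0 := htop Submodule.mem_top
    exact hx (by simpa [f] using h2)
  obtain ⟨i, hi, hi'⟩ := hex
  refine ⟨i, ⟨?_⟩⟩
  let g : ↥(s i.succ) →ₗ[R] S := f.domRestrict _
  have hg0 : g ≠ 0 := by
    intro h
    exact hi' fun y hy => by
      have := LinearMap.congr_fun h ⟨y, hy⟩
      simpa [g] using this
  have hcov : s i.castSucc ⋖ s i.succ := s.step i
  have hsimple := (covBy_iff_quot_is_simple hcov.le).1 hcov
  have hle : (s i.castSucc).submoduleOf (s i.succ) ≤ LinearMap.ker g := by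
    intro y hy
    exact hi hy
  let q := ((s i.castSucc).submoduleOf (s i.succ)).liftQ g hle
  have hq0 : q ≠ 0 := by
    intro h
    apply hg0
    ext y
    simpa [q] using LinearMap.congr_fun h (Submodule.Quotient.mk y)
  have : IsSimpleModule R (↥(s i.succ) ⧸ (s i.castSucc).submoduleOf (s i.succ)) := hsimple
  exact LinearEquiv.ofBijective q (LinearMap.bijective_of_ne_zero hq0)

/-- There are only finitely many irreducible Brauer characters. -/
theorem Block.finite_irr (B : Block k G) (θ : RootLift p k G) : (B.Irr θ).Finite := by
  obtain ⟨s, h0, h1⟩ := exists_compositionSeries_of_isNoetherian_isArtinian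
    (MonoidAlgebra k G) (MonoidAlgebra k G)
  refine (Set.finite_range fun i : Fin s.length =>
    brauerCharacter θ (↥(s i.succ) ⧸ (s i.castSucc).submoduleOf (s i.succ))).subset ?_
  rintro φ ⟨I, hI, -, rfl⟩
  obtain ⟨i, ⟨e⟩⟩ := exists_factor_equiv (S := MonoidAlgebra k G ⧸ I) s h0 h1
  exact ⟨i, brauerCharacter_congr θ e⟩

instance (B : Block k G) (θ : RootLift p k G) : Fintype (B.Irr θ) :=
  (B.finite_irr θ).fintype

/-- `l(B)`, the number of irreducible Brauer characters of `B`. -/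
def Block.l (B : Block k G) (θ : RootLift p k G) : ℕ := Fintype.card (B.Irr θ)

/-! ### The Cartan matrix -/

/-- A simple module, in the form of a quotient of the regular module, with Brauer character `φ`. -/
abbrev Block.SimpleModule (B : Block k G) {θ : RootLift p k G} (φ : B.Irr θ) : Type _ :=
  MonoidAlgebra k G ⧸ φ.2.choose

instance (B : Block k G) {θ : RootLift p k G} (φ : B.Irr θ) :
    IsSimpleModule (MonoidAlgebra k G) (B.SimpleModule φ) := φ.2.choose_spec.1

/-- The principal indecomposable module with the simple head that affords `φ`. -/
def Block.pim (B : Block k G) {θ : RootLift p k G} (φ : B.Irr θ) :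
    Submodule (MonoidAlgebra k G) (MonoidAlgebra k G) :=
  (exists_isPrincipalIndecomposable (R := MonoidAlgebra k G) (B.SimpleModule φ)).choose

/-- The Cartan matrix of `B`: its entry at `(φ, ψ)` is the multiplicity of the simple module
affording `φ` as a composition factor of the principal indecomposable module with head
affording `ψ`. -/
def Block.cartanMatrix (B : Block k G) (θ : RootLift p k G) : Matrix (B.Irr θ) (B.Irr θ) ℕ :=
  Matrix.of fun φ ψ => compositionMultiplicity (MonoidAlgebra k G) (B.pim ψ) (B.SimpleModule φ)

/-- The inequality `dim B / (l(B) |D|) ≤ ∑ φ(1)²` over the irreducible Brauer characters `φ`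
of `B`, with equality if and only if `l(B) = 1`. (The degrees `φ(1)` are complex numbers; the
inequality is taken in the partial order of `ℂ`, which restricts to that of `ℝ`.) -/
def Block.LocalConjecture [Fact p.Prime] (B : Block k G) (θ : RootLift p k G)
    (D : Subgroup G) : Prop :=
  (B.dim : ℂ) / ((B.l θ : ℂ) * (Nat.card D : ℂ)) ≤ ∑ φ : B.Irr θ, (φ : PRegular p G → ℂ) 1 ^ 2 ∧
  ((B.dim : ℂ) / ((B.l θ : ℂ) * (Nat.card D : ℂ)) = ∑ φ : B.Irr θ, (φ : PRegular p G → ℂ) 1 ^ 2 ↔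
    B.l θ = 1)

end Irr

end ModRep

end

noncomputable section

namespace ModRep

universe u v w

/-! ### Primitive idempotents and simple modules of finite-dimensional algebras -/

section FiniteDimensional

variable {k : Type*} {A : Type*} [Field k] [Ring A] [Algebra k A]

/-! Let `A = kG`, let `e φ` be a primitive idempotent whose module `A (e φ)` has head affording `φ`,
and let `n φ = φ(1)`. The Cartan numbers are the dimensions of the spaces `(e φ) A (e ψ)`, and
counting composition factors on both sides gives `dim B = ∑ n φ * n ψ * c φ ψ`.

Idempotents lift to the Witt vectors of `k`, and from there map to a semisimple group algebra over
an algebraically closed field of characteristic zero. Dimensions of spaces `e A f` survive this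
passage, and there they are `∑ i, m e i * m f i`, where `m e i` is the value of the `i`-th
irreducible character at the lift of `e` (`exists_decomposition`). So `C` is a Gram matrix, and the
inequality of (a) is Cauchy-Schwarz (`sum_gram_le`).

In the case of equality all the vectors `m (e φ)` are proportional. If `φ ≠ ψ`, then coprime `a`,
`b` satisfy `a * m (e φ) = b * m (e ψ)`, so the class sums of the lifts satisfy the same relation.
Reduced to `k` and read as a relation between traces on the simple modules of `φ` and `ψ`, it says
that `p` divides both `a` and `b`, a contradiction.

For (b), the chain `dim B ≤ tr C * ∑ n φ ^ 2 ≤ l(B) * |D| * ∑ n φ ^ 2` leaves only `|D| ≤ tr C` when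
`l(B) = 1`. In that case the vector of the block idempotent is `n φ` times that of `e φ`. Comparing
class sums at an element `y` of the support of the block idempotent that is centralized by `D`
(`Block.exists_coeff_ne_zero_of_isDefectGroup`) shows that `|D|` divides the single Cartan number
(`Block.card_dvd_of_proportional`). -/

theorem exists_pow_eq_pow_succ_mul [FiniteDimensional k A] (x : A) :
    ∃ n : ℕ, ∃ z ∈ Algebra.adjoin k {x}, x ^ n = x ^ (n + 1) * z := by
  have hint : IsIntegral k x := Algebra.IsIntegral.isIntegral x
  -- The minimal polynomial is `X ^ n * r` with `r(0) ≠ 0`. Solving `x ^ n * r(x) = 0` for the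
  -- constant term of `r` gives `z`.
  obtain ⟨r, hr, hdvd⟩ := Polynomial.exists_eq_pow_rootMultiplicity_mul_and_not_dvd
    (minpoly k x) (minpoly.ne_zero hint) 0
  rw [map_zero, sub_zero] at hr hdvd
  set n := (minpoly k x).rootMultiplicity 0
  have hc : r.coeff 0 ≠ 0 := fun h => hdvd (Polynomial.X_dvd_iff.2 h)
  have h0 : x ^ n * Polynomial.aeval x r = 0 := by
    have := minpoly.aeval k x
    rw [hr] at this
    simpa using this
  rw [← Polynomial.divX_mul_X_add r] at h0
  refine ⟨n, -((r.coeff 0)⁻¹ • Polynomial.aeval x r.divX), neg_mem (Subalgebra.smul_mem _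
    (Polynomial.aeval_mem_adjoin_singleton k x) _), ?_⟩
  have hcomm : Polynomial.aeval x r.divX * x = x * Polynomial.aeval x r.divX := by
    have h := congrArg (Polynomial.aeval x) (Polynomial.X_mul (p := r.divX))
    simpa using h.symm
  simp only [map_add, map_mul, Polynomial.aeval_X, Polynomial.aeval_C, mul_add, hcomm] at h0
  rw [← Algebra.commutes, ← Algebra.smul_def] at h0
  rw [mul_neg, mul_smul_comm, pow_succ, mul_assoc, eq_neg_of_add_eq_zero_left h0, smul_neg,
    neg_neg, smul_smul, inv_mul_cancel₀ hc, one_smul]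

theorem commute_of_mem_adjoin_singleton {x z : A} (hz : z ∈ Algebra.adjoin k {x}) {y : A}
    (hy : Commute y x) : Commute y z := by
  have h : Algebra.adjoin k {x} ≤ Subalgebra.centralizer k {y} := by
    rw [Algebra.adjoin_le_iff]
    rintro _ rfl
    exact (Subalgebra.mem_centralizer_iff k).2 fun g hg => by rw [Set.mem_singleton_iff.1 hg]; exact hy
  exact (Subalgebra.mem_centralizer_iff k).1 (h hz) y rfl

/-- Every element of a finite-dimensional algebra has a power that generates an idempotent. -/
theorem exists_pow_mul_isIdempotentElem [FiniteDimensional k A] (x : A) :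
    ∃ n : ℕ, ∃ y : A, (∀ a : A, Commute a x → Commute a y) ∧
      IsIdempotentElem (x ^ (n + 1) * y) ∧ x ^ (n + 1) = x ^ (n + 1) * (x ^ (n + 1) * y) := by
  obtain ⟨n, z, hz, hx⟩ := exists_pow_eq_pow_succ_mul (k := k) x
  have hxz : Commute x z := commute_of_mem_adjoin_singleton hz (Commute.refl x)
  have hm : ∀ m : ℕ, x ^ n = x ^ (n + m) * z ^ m := by
    intro m
    induction m with
    | zero => simp
    | succ m ih =>
      calc x ^ n = x ^ (n + 1) * z := hx
        _ = x * x ^ n * z := by rw [pow_succ']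
        _ = x * (x ^ (n + m) * z ^ m) * z := by rw [← ih]
        _ = x ^ (n + (m + 1)) * z ^ (m + 1) := by
          rw [← add_assoc, pow_succ' x, pow_succ z]; simp only [mul_assoc]
  have key : x ^ (n + 1) = x ^ (n + 1) * (x ^ (n + 1) * z ^ (n + 1)) := by
    calc x ^ (n + 1) = x * x ^ n := pow_succ' _ _
      _ = x * (x ^ (n + (n + 1)) * z ^ (n + 1)) := by rw [← hm]
      _ = _ := by rw [← mul_assoc, ← mul_assoc, ← pow_succ', ← pow_add]; congr 2; ring
  -- The exponent `n + 1` instead of `n` leaves a factor `x` in the idempotent even for `n = 0`, so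
  -- that `e * x = x` implies that `e` fixes the idempotent as well.
  refine ⟨n, z ^ (n + 1), fun a ha => (commute_of_mem_adjoin_singleton hz ha).pow_right _, ?_, key⟩
  have hc : Commute (x ^ (n + 1)) (z ^ (n + 1)) := hxz.pow_pow _ _
  unfold IsIdempotentElem
  calc x ^ (n + 1) * z ^ (n + 1) * (x ^ (n + 1) * z ^ (n + 1))
      = x ^ (n + 1) * (z ^ (n + 1) * x ^ (n + 1)) * z ^ (n + 1) := by simp only [mul_assoc]
    _ = x ^ (n + 1) * (x ^ (n + 1) * z ^ (n + 1)) * z ^ (n + 1) := by rw [hc.eq]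
    _ = _ := by rw [← key]

/-- If `e` is a primitive idempotent, the ring `e A e` is local. -/
theorem IsPrimitiveIdempotent.isNilpotent_or_exists_mul_eq [FiniteDimensional k A] {e x : A}
    (he : IsPrimitiveIdempotent e) (hex : e * x = x) (hxe : x * e = x) :
    IsNilpotent x ∨ ∃ y, y * x = e := by
  obtain ⟨n, y, hy, hidem, hpow⟩ := exists_pow_mul_isIdempotentElem (k := k) x
  set f := x ^ (n + 1) * y with hf
  have hyx : Commute x y := hy x (Commute.refl x)
  have hey : Commute e y := hy e (by rw [Commute, SemiconjBy, hex, hxe])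
  have hef : e * f = f := by rw [hf, pow_succ', ← mul_assoc, ← mul_assoc, hex]
  have hfe : f * e = f := by
    rw [hf, mul_assoc, ← hey.eq, ← mul_assoc, pow_succ, mul_assoc (x ^ n), hxe]
  -- Fitting decomposition `e = f + (e - f)`: for `f = 0` the element `x` is nilpotent, for `f = e`
  -- it is invertible in `e A e`.
  rcases he.indecomposable f (e - f) hidem
    (by simp only [IsIdempotentElem, mul_sub, sub_mul, he.idem.eq, hef, hfe, hidem.eq]; abel)
    (by rw [mul_sub, hfe, hidem.eq, sub_self]) (by rw [sub_mul, hef, hidem.eq, sub_self])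
    (by abel) with h | h
  · exact Or.inl ⟨n + 1, by rw [hpow, h, mul_zero]⟩
  · refine Or.inr ⟨y * x ^ n, ?_⟩
    rw [sub_eq_zero.1 h, mul_assoc, ← pow_succ, hf, (hyx.pow_left (n + 1)).eq]

/-- Rosenberg's lemma for a single element: the local ring `e Z(A)`. -/
theorem IsBlockIdempotent.isNilpotent_or_exists_mul_eq [FiniteDimensional k A] {e x : A}
    (he : IsBlockIdempotent e) (hx : x ∈ Set.center A) (hex : e * x = x) :
    IsNilpotent x ∨ ∃ y ∈ Set.center A, x * y = e := by
  obtain ⟨n, y, hy, hidem, hpow⟩ := exists_pow_mul_isIdempotentElem (k := k) x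
  have hyc : y ∈ Set.center A := Semigroup.mem_center_iff.2 fun a =>
    (hy a (Semigroup.mem_center_iff.1 hx a)).eq
  have hxp : ∀ m, x ^ m ∈ Set.center A := fun m => (Submonoid.center A).pow_mem hx m
  have hfc : x ^ (n + 1) * y ∈ Set.center A := Set.mul_mem_center (hxp _) hyc
  set f := x ^ (n + 1) * y with hf
  have hef : e * f = f := by rw [hf, pow_succ', ← mul_assoc, ← mul_assoc, hex]
  have hfe : f * e = f := by rw [← Semigroup.mem_center_iff.1 hfc e, hef]
  rcases he.indecomposable f (e - f) hfc
    ((Subring.center A).sub_mem he.central hfc) hidem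
    (by simp only [IsIdempotentElem, mul_sub, sub_mul, he.idem.eq, hef, hfe, hidem.eq]; abel)
    (by rw [mul_sub, hfe, hidem.eq, sub_self]) (by abel) with h | h
  · exact Or.inl ⟨n + 1, by rw [hpow, h, mul_zero]⟩
  · refine Or.inr ⟨x ^ n * y, Set.mul_mem_center (hxp _) hyc, ?_⟩
    rw [sub_eq_zero.1 h, ← mul_assoc, ← pow_succ']

/-- Rosenberg's lemma: a sum of central elements that equals a block idempotent `e` has a summand
that divides `e` in the center. -/
theorem IsBlockIdempotent.exists_mul_eq_of_sum_eq [FiniteDimensional k A] {e : A}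
    (he : IsBlockIdempotent e) {ι : Type*} (s : Finset ι) (z : ι → A)
    (hz : ∀ i ∈ s, z i ∈ Set.center A) (hsum : ∑ i ∈ s, z i = e) :
    ∃ i ∈ s, ∃ y ∈ Set.center A, z i * y = e := by
  by_contra! hcon
  have hnil : ∀ i ∈ s, IsNilpotent (e * z i) := by
    intro i hi
    refine (he.isNilpotent_or_exists_mul_eq (k := k) (Set.mul_mem_center he.central (hz i hi))
      (by rw [← mul_assoc, he.idem.eq])).resolve_right ?_
    rintro ⟨y, hy, h⟩
    refine hcon i hi (e * y) (Set.mul_mem_center he.central hy) ?_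
    rw [← mul_assoc, Semigroup.mem_center_iff.1 he.central (z i)]
    exact h
  have hcomm : ∀ i ∈ s, ∀ j ∈ s, Commute (e * z i) (e * z j) := fun i hi j hj =>
    Semigroup.mem_center_iff.1 (Set.mul_mem_center he.central (hz j hj)) _
  have key : ∀ t : Finset ι, t ⊆ s → IsNilpotent (∑ i ∈ t, e * z i) := by
    classical
    intro t
    induction t using Finset.induction_on with
    | empty => intro _; simp
    | insert a t ha ih =>
      intro hts
      rw [Finset.sum_insert ha]
      refine Commute.isNilpotent_add (Commute.sum_right _ _ _ fun i hi => hcomm _ ?_ _ ?_)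
        (hnil a ?_) (ih ?_)
      · exact hts (Finset.mem_insert_self _ _)
      · exact hts (Finset.mem_insert_of_mem hi)
      · exact hts (Finset.mem_insert_self _ _)
      · exact fun i hi => hts (Finset.mem_insert_of_mem hi)
  obtain ⟨m, hm⟩ := key s subset_rfl
  rw [← Finset.mul_sum, hsum, he.idem.eq] at hm
  exact he.ne_zero (he.idem.pow_succ_eq m ▸ by rw [pow_succ, hm, zero_mul])

section Simple

variable {S : Type v} [AddCommGroup S] [Module A S]
  {T : Type w} [AddCommGroup T] [Module A T]

/-- A primitive idempotent has no element separating two nonzero vectors of simple modules that it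
fixes. -/
theorem IsPrimitiveIdempotent.not_exists_smul_eq [FiniteDimensional k A] {e : A}
    (he : IsPrimitiveIdempotent e) {s : S} {t : T} (hs : e • s = s) (ht : e • t = t)
    (hs0 : s ≠ 0) (ht0 : t ≠ 0) (a : A) (has : a • s = s) (hat : a • t = 0) : False := by
  -- The element `e * a * e` fixes `s`, hence is not nilpotent, and kills `t`, hence is not
  -- invertible in `e A e`.
  rcases he.isNilpotent_or_exists_mul_eq (k := k) (x := e * a * e)
    (by simp only [← mul_assoc, he.idem.eq]) (by simp only [mul_assoc, he.idem.eq]) with h | ⟨y, hy⟩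
  · obtain ⟨n, hn⟩ := h
    have h1 : ∀ n : ℕ, ((e * a * e) ^ n) • s = s := by
      intro n
      induction n with
      | zero => simp
      | succ n ih => rw [pow_succ, mul_smul, mul_smul, mul_smul, hs, has, hs, ih]
    have := h1 n
    rw [hn, zero_smul] at this
    exact hs0 this.symm
  · apply ht0
    rw [← ht, ← hy, mul_smul, mul_smul, mul_smul, ht, hat, smul_zero, smul_zero]

/-- A nonzero kernel element has the form `b • (s, t)` with `b • t = 0` and `b • s ≠ 0`; by
simplicity some `c` takes `b • s` back to `s`. -/
theorem exists_smul_eq_of_isSimpleModule_fst [IsSimpleModule A S] {s : S}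
    {t : T}
    (h : ¬ Function.Injective
      ((LinearMap.snd A S T).domRestrict (Submodule.span A {(s, t)}))) :
    ∃ a : A, a • s = s ∧ a • t = 0 := by
  rw [← LinearMap.ker_eq_bot, Submodule.eq_bot_iff] at h
  push Not at h
  obtain ⟨⟨x, hx⟩, hker, hne⟩ := h
  obtain ⟨b, rfl⟩ := Submodule.mem_span_singleton.1 hx
  have hbt : b • t = 0 := by simpa using hker
  have hbs : b • s ≠ 0 := by
    intro h0
    apply hne
    ext <;> simp [h0, hbt]
  have htop := IsSimpleModule.toSpanSingleton_surjective A hbs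
  obtain ⟨c, hc⟩ := htop s
  refine ⟨c * b, ?_, ?_⟩
  · rw [mul_smul]; simpa using hc
  · rw [mul_smul, hbt, smul_zero]

theorem exists_smul_eq_of_isSimpleModule_snd [IsSimpleModule A T] {s : S}
    {t : T}
    (h : ¬ Function.Injective
      ((LinearMap.fst A S T).domRestrict (Submodule.span A {(s, t)}))) :
    ∃ a : A, a • t = t ∧ a • s = 0 := by
  rw [← LinearMap.ker_eq_bot, Submodule.eq_bot_iff] at h
  push Not at h
  obtain ⟨⟨x, hx⟩, hker, hne⟩ := h
  obtain ⟨b, rfl⟩ := Submodule.mem_span_singleton.1 hx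
  have hbs : b • s = 0 := by simpa using hker
  have hbt : b • t ≠ 0 := by
    intro h0
    apply hne
    ext <;> simp [h0, hbs]
  obtain ⟨c, hc⟩ := IsSimpleModule.toSpanSingleton_surjective A hbt t
  refine ⟨c * b, ?_, ?_⟩
  · rw [mul_smul]; simpa using hc
  · rw [mul_smul, hbs, smul_zero]

/-- If a primitive idempotent fixes nonzero vectors of two simple modules, then there is an
isomorphism between them that takes one vector to the other. -/
theorem IsPrimitiveIdempotent.exists_linearEquiv [FiniteDimensional k A] [IsSimpleModule A S]
    [IsSimpleModule A T] {e : A}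
    (he : IsPrimitiveIdempotent e) {s : S} {t : T} (hs : e • s = s) (ht : e • t = t)
    (hs0 : s ≠ 0) (ht0 : t ≠ 0) : ∃ α : S ≃ₗ[A] T, α s = t := by
  -- The submodule generated by `(s, t)` projects isomorphically to both factors, so it is the graph
  -- of the required isomorphism.
  have hsnd : Function.Injective
      ((LinearMap.snd A S T).domRestrict (Submodule.span A {(s, t)})) := by
    by_contra h
    obtain ⟨a, h1, h2⟩ := exists_smul_eq_of_isSimpleModule_fst h
    exact he.not_exists_smul_eq (k := k) hs ht hs0 ht0 a h1 h2
  have hfst : Function.Injective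
      ((LinearMap.fst A S T).domRestrict (Submodule.span A {(s, t)})) := by
    by_contra h
    obtain ⟨a, h1, h2⟩ := exists_smul_eq_of_isSimpleModule_snd h
    exact he.not_exists_smul_eq (k := k) ht hs ht0 hs0 a h1 h2
  let p : Submodule.span A {(s, t)} := ⟨(s, t), Submodule.mem_span_singleton_self _⟩
  have hfs : Function.Surjective
      ((LinearMap.fst A S T).domRestrict (Submodule.span A {(s, t)})) :=
    LinearMap.surjective_of_ne_zero fun h => hs0 (by simpa using LinearMap.congr_fun h p)
  have hss : Function.Surjective
      ((LinearMap.snd A S T).domRestrict (Submodule.span A {(s, t)})) :=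
    LinearMap.surjective_of_ne_zero fun h => ht0 (by simpa using LinearMap.congr_fun h p)
  let α := LinearEquiv.ofBijective _ ⟨hfst, hfs⟩
  let β := LinearEquiv.ofBijective _ ⟨hsnd, hss⟩
  refine ⟨α.symm.trans β, ?_⟩
  have h1 : α.symm s = p := α.symm_apply_eq.2 rfl
  rw [LinearEquiv.trans_apply, h1]
  rfl

end Simple

/-! ### The dimension of `e M` -/

/-- The dimension of `e M`. -/
def idemDim (k : Type*) {A : Type*} [Field k] [Ring A] [Algebra k A] (e : A) (M : Type*)
    [AddCommGroup M] [Module k M] [Module A M] [IsScalarTower k A M] : ℕ :=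
  Module.finrank k (LinearMap.range (Algebra.lsmul k k M e))

theorem mem_range_lsmul_iff {M : Type*} [AddCommGroup M] [Module k M] [Module A M]
    [IsScalarTower k A M] {e : A} (he : IsIdempotentElem e) {x : M} :
    x ∈ LinearMap.range (Algebra.lsmul k k M e) ↔ e • x = x := by
  constructor
  · rintro ⟨y, rfl⟩
    simp [smul_smul, he.eq]
  · intro h
    exact ⟨x, h⟩

section Additive

variable {M : Type*} [AddCommGroup M] [Module k M] [Module A M] [IsScalarTower k A M]
  {N : Type*} [AddCommGroup N] [Module k N] [Module A N] [IsScalarTower k A N]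

theorem idemDim_congr (e : A) (f : M ≃ₗ[A] N) : idemDim k e M = idemDim k e N := by
  let g : M ≃ₗ[k] N := f.restrictScalars k
  have h : Submodule.map (g : M →ₗ[k] N) (LinearMap.range (Algebra.lsmul k k M e)) =
      LinearMap.range (Algebra.lsmul k k N e) := by
    ext x
    constructor
    · rintro ⟨_, ⟨y, rfl⟩, rfl⟩
      exact ⟨g y, by simp [g]⟩
    · rintro ⟨y, rfl⟩
      exact ⟨e • g.symm y, ⟨g.symm y, rfl⟩, by simp [g]⟩
  unfold idemDim
  rw [← h]
  exact (LinearEquiv.finrank_map_eq g _).symm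

theorem idemDim_one : idemDim k (1 : A) M = Module.finrank k M := by
  have h : LinearMap.range (Algebra.lsmul k k M (1 : A)) = ⊤ := by
    rw [map_one]
    exact LinearMap.range_id
  rw [idemDim, h, finrank_top]

theorem idemDim_eq_zero_iff [FiniteDimensional k M] {e : A} :
    idemDim k e M = 0 ↔ ∀ x : M, e • x = 0 := by
  unfold idemDim
  rw [Submodule.finrank_eq_zero, LinearMap.range_eq_bot, LinearMap.ext_iff]
  rfl

/-- Exactness of `M ↦ e M`: the projection `e M → M ⧸ N` has image `e (M ⧸ N)` and kernel `e M ∩ N =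
e N`. -/
theorem idemDim_add_quotient [FiniteDimensional k M] {e : A} (he : IsIdempotentElem e)
    (N : Submodule A M) : idemDim k e N + idemDim k e (M ⧸ N) = idemDim k e M := by
  let E := LinearMap.range (Algebra.lsmul k k M e)
  let φ : E →ₗ[k] M ⧸ N := (N.mkQ.restrictScalars k).domRestrict E
  have hr : LinearMap.range φ = LinearMap.range (Algebra.lsmul k k (M ⧸ N) e) := by
    ext x
    constructor
    · rintro ⟨⟨_, y, rfl⟩, rfl⟩
      exact ⟨N.mkQ y, by simp [φ]⟩
    · rintro ⟨y, rfl⟩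
      obtain ⟨y, rfl⟩ := N.mkQ_surjective y
      exact ⟨⟨e • y, y, rfl⟩, by simp [φ]⟩
  have hk : (LinearMap.ker φ).map E.subtype =
      (LinearMap.range (Algebra.lsmul k k N e)).map (N.subtype.restrictScalars k) := by
    ext x
    constructor
    · rintro ⟨⟨x, hx⟩, hker, rfl⟩
      have hxN : x ∈ N := by simpa [φ] using hker
      exact ⟨⟨x, hxN⟩, (mem_range_lsmul_iff he).2
        (Subtype.ext ((mem_range_lsmul_iff he).1 hx)), rfl⟩
    · rintro ⟨x, hx, rfl⟩
      have h2 := (mem_range_lsmul_iff he).1 hx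
      exact ⟨⟨x, (mem_range_lsmul_iff he).2 (by simpa using congrArg Subtype.val h2)⟩,
        by simp [φ], rfl⟩
  have h1 := LinearMap.finrank_range_add_finrank_ker φ
  have h2 : Module.finrank k (LinearMap.ker φ) = idemDim k e N := by
    rw [← Submodule.finrank_map_subtype_eq, hk, idemDim]
    exact (Submodule.equivMapOfInjective (N.subtype.restrictScalars k) N.subtype_injective
      (LinearMap.range (Algebra.lsmul k k N e))).finrank_eq.symm
  rw [hr, h2] at h1
  rw [add_comm]
  exact h1

end Additive

/-! ### Composition multiplicities as dimensions of `e M` -/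

section Series

variable {M : Type v} [AddCommGroup M] [Module k M] [Module A M] [IsScalarTower k A M]

theorem isSimpleModule_factor (s : CompositionSeries (Submodule A M)) (i : Fin s.length) :
    IsSimpleModule A (↥(s i.succ) ⧸ (s i.castSucc).submoduleOf (s i.succ)) :=
  (covBy_iff_quot_is_simple (s.step i).le).1 (s.step i)

variable [FiniteDimensional k M]

theorem finiteDimensional_coe_submodule (N : Submodule A M) : FiniteDimensional k N :=
  inferInstanceAs (FiniteDimensional k (N.restrictScalars k))

theorem idemDim_eq_sum {e : A} (he : IsIdempotentElem e) (s : CompositionSeries (Submodule A M))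
    (h0 : s.head = ⊥) (h1 : s.last = ⊤) :
    idemDim k e M = ∑ i : Fin s.length,
      idemDim k e (↥(s i.succ) ⧸ (s i.castSucc).submoduleOf (s i.succ)) := by
  have hstep : ∀ i : Fin s.length, idemDim k e (s i.succ) = idemDim k e (s i.castSucc) +
      idemDim k e (↥(s i.succ) ⧸ (s i.castSucc).submoduleOf (s i.succ)) := by
    intro i
    have := finiteDimensional_coe_submodule (k := k) (s i.succ)
    have hle : s i.castSucc ≤ s i.succ := (s.step i).le
    rw [← idemDim_add_quotient he ((s i.castSucc).submoduleOf (s i.succ)),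
      idemDim_congr e (Submodule.submoduleOfEquivOfLe hle)]
  -- Telescoping: the sum over all members of the series is split off at its first and at its last
  -- term.
  have hsum := (Fin.sum_univ_succ fun i => idemDim k e (s i)).symm.trans
    (Fin.sum_univ_castSucc fun i => idemDim k e (s i))
  have hbot : idemDim k e (s 0) = 0 := by
    have := finiteDimensional_coe_submodule (k := k) (s 0)
    rw [idemDim_eq_zero_iff]
    rintro ⟨x, hx⟩
    have : x = 0 := by
      rw [← Submodule.mem_bot A, ← h0]
      exact hx
    subst this
    exact Subtype.ext (smul_zero e)
  have htop : idemDim k e (s (Fin.last _)) = idemDim k e M :=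
    idemDim_congr e ((LinearEquiv.ofEq _ _ h1).trans Submodule.topEquiv)
  simp only [hstep, Finset.sum_add_distrib, hbot, htop] at hsum
  omega

/-- An idempotent that has rank one on `S` and kills every other simple module counts the factors
`S`, because `idemDim` is additive along the composition series. -/
theorem compositionMultiplicity_eq_idemDim [IsNoetherian A M] [IsArtinian A M] {e : A} (he : IsIdempotentElem e)
    {S : Type*} [AddCommGroup S] [Module A S]
    (h1 : ∀ (T : Type v) [AddCommGroup T] [Module k T] [Module A T] [IsScalarTower k A T]
      [FiniteDimensional k T] [IsSimpleModule A T], Nonempty (T ≃ₗ[A] S) → idemDim k e T = 1)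
    (h2 : ∀ (T : Type v) [AddCommGroup T] [Module k T] [Module A T] [IsScalarTower k A T]
      [FiniteDimensional k T] [IsSimpleModule A T], ¬ Nonempty (T ≃ₗ[A] S) → idemDim k e T = 0) :
    compositionMultiplicity A M S = idemDim k e M := by
  classical
  unfold compositionMultiplicity
  set s := (exists_compositionSeries_of_isNoetherian_isArtinian A M).choose with hs
  obtain ⟨hs0, hs1⟩ := (exists_compositionSeries_of_isNoetherian_isArtinian A M).choose_spec
  rw [← hs] at hs0 hs1
  have hval : ∀ i : Fin s.length,
      idemDim k e (↥(s i.succ) ⧸ (s i.castSucc).submoduleOf (s i.succ)) =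
      if Nonempty ((↥(s i.succ) ⧸ (s i.castSucc).submoduleOf (s i.succ)) ≃ₗ[A] S)
        then 1 else 0 := by
    intro i
    have := isSimpleModule_factor s i
    have := finiteDimensional_coe_submodule (k := k) (s i.succ)
    split_ifs with h
    · exact h1 _ h
    · exact h2 _ h
  rw [idemDim_eq_sum he s hs0 hs1, Finset.sum_congr rfl fun i _ => hval i, Finset.sum_boole,
    Nat.card_eq_fintype_card, Fintype.card_subtype]
  rfl

end Series

/-! ### Primitive idempotents acting on simple modules -/

section Primitive

variable {S : Type v} [AddCommGroup S] [Module k S] [Module A S]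
  [IsScalarTower k A S] [FiniteDimensional k S] [IsSimpleModule A S]

/-- Schur's lemma: an eigenvector exists and generates `S`, so the eigenvalue determines the whole
endomorphism. -/
theorem exists_eq_smul_of_isSimpleModule [IsAlgClosed k] (α : S →ₗ[A] S) :
    ∃ c : k, ∀ s, α s = c • s := by
  have := IsSimpleModule.nontrivial A S
  obtain ⟨c, hc⟩ := Module.End.exists_eigenvalue (α.restrictScalars k)
  obtain ⟨x, hx⟩ := hc.exists_hasEigenvector
  refine ⟨c, fun s => ?_⟩
  obtain ⟨a, rfl⟩ := IsSimpleModule.toSpanSingleton_surjective A hx.2 s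
  have hxc : α x = c • x := hx.apply_eq_smul
  rw [LinearMap.toSpanSingleton_apply, map_smul, hxc, ← smul_assoc c, ← algebraMap_smul A c x,
    smul_smul, ← Algebra.commutes, ← Algebra.smul_def]

variable [FiniteDimensional k A]
  {T : Type w} [AddCommGroup T] [Module k T] [Module A T]
  [IsScalarTower k A T] [FiniteDimensional k T] [IsSimpleModule A T]

theorem IsPrimitiveIdempotent.nonempty_linearEquiv {e : A} (he : IsPrimitiveIdempotent e)
    (hS : idemDim k e S ≠ 0) (hT : idemDim k e T ≠ 0) : Nonempty (T ≃ₗ[A] S) := by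
  rw [Ne, idemDim_eq_zero_iff] at hS hT
  push Not at hS hT
  obtain ⟨s, hs⟩ := hS
  obtain ⟨t, ht⟩ := hT
  obtain ⟨α, -⟩ := he.exists_linearEquiv (k := k) (s := e • t) (t := e • s)
    (by rw [smul_smul, he.idem.eq]) (by rw [smul_smul, he.idem.eq]) ht hs
  exact ⟨α⟩

/-- Any two nonzero vectors of `e S` are exchanged by an automorphism of `S`, which is a scalar by
Schur's lemma. -/
theorem IsPrimitiveIdempotent.idemDim_eq_one [IsAlgClosed k] {e : A}
    (he : IsPrimitiveIdempotent e) (hS : idemDim k e S ≠ 0) : idemDim k e S = 1 := by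
  have hS' := hS
  rw [Ne, idemDim_eq_zero_iff] at hS'
  push Not at hS'
  obtain ⟨s, hs⟩ := hS'
  refine finrank_eq_one (⟨e • s, s, rfl⟩ : LinearMap.range (Algebra.lsmul k k S e))
    (fun h => hs (congrArg Subtype.val h)) ?_
  rintro ⟨_, t, rfl⟩
  by_cases ht : e • t = 0
  · exact ⟨0, Subtype.ext (by simp [ht])⟩
  obtain ⟨α, hα⟩ := he.exists_linearEquiv (k := k) (s := e • s) (t := e • t)
    (by rw [smul_smul, he.idem.eq]) (by rw [smul_smul, he.idem.eq]) hs ht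
  obtain ⟨c, hc⟩ := exists_eq_smul_of_isSimpleModule (k := k) (α : S →ₗ[A] S)
  refine ⟨c, Subtype.ext ?_⟩
  have h2 := hc (e • s)
  simp only [LinearEquiv.coe_coe, hα] at h2
  simpa using h2.symm

end Primitive

end FiniteDimensional

/-! ### Eigenvalues of powers of an endomorphism -/

section Eigenvalues

variable {k : Type*} [Field k] [IsAlgClosed k] {V : Type*} [AddCommGroup V] [Module k V]
  [FiniteDimensional k V]

theorem card_roots_charpoly (f : Module.End k V) :
    Multiset.card f.charpoly.roots = Module.finrank k V := by
  rw [IsAlgClosed.card_roots_eq_natDegree, LinearMap.charpoly_natDegree]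

/-- Both sides are multiplicative in `q`, so constants and the factors `X - μ` suffice; for the
latter both sides are, up to the same sign, the characteristic polynomial at `μ`. -/
theorem det_aeval_eq_prod_roots_charpoly (f : Module.End k V) (q : Polynomial k) :
    LinearMap.det (Polynomial.aeval f q) = (f.charpoly.roots.map q.eval).prod := by
  have hC : ∀ a : k, LinearMap.det (Polynomial.aeval f (Polynomial.C a)) =
      (f.charpoly.roots.map (Polynomial.C a).eval).prod := by
    intro a
    simp only [Polynomial.aeval_C, Polynomial.eval_C, Multiset.map_const', Multiset.prod_replicate,
      card_roots_charpoly, Algebra.algebraMap_eq_smul_one, LinearMap.det_smul, map_one, mul_one]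
  have hX : ∀ μ : k, LinearMap.det (Polynomial.aeval f (Polynomial.X - Polynomial.C μ)) =
      (f.charpoly.roots.map (Polynomial.X - Polynomial.C μ).eval).prod := by
    intro μ
    have h1 : Polynomial.aeval f (Polynomial.X - Polynomial.C μ) =
        (-1 : k) • (algebraMap k (Module.End k V) μ - f) := by
      simp
    have h2 : f.charpoly.roots.map (Polynomial.X - Polynomial.C μ).eval =
        (f.charpoly.roots.map (fun a => μ - a)).map (fun x => -1 * x) := by
      rw [Multiset.map_map]
      simp
    rw [h1, LinearMap.det_smul, ← LinearMap.eval_charpoly, h2, Multiset.prod_map_mul,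
      Multiset.map_id', Multiset.map_const', Multiset.prod_replicate, Multiset.card_map,
      card_roots_charpoly, (IsAlgClosed.splits f.charpoly).eval_eq_prod_roots_of_monic
        f.charpoly_monic]
  have hmul : ∀ q r : Polynomial k, (f.charpoly.roots.map (q * r).eval).prod =
      (f.charpoly.roots.map q.eval).prod * (f.charpoly.roots.map r.eval).prod := by
    intro q r
    rw [← Multiset.prod_map_mul]
    simp
  rw [(IsAlgClosed.splits q).eq_prod_roots, map_mul, map_mul, hC, hmul]
  congr 1
  induction q.roots using Multiset.induction_on with
  | empty => simp
  | cons μ s ih => rw [Multiset.map_cons, Multiset.prod_cons, map_mul, map_mul, hX, hmul, ih]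

/-- The eigenvalues of a power are the powers of the eigenvalues, with multiplicities. -/
theorem roots_charpoly_pow (f : Module.End k V) (j : ℕ) :
    (f ^ j).charpoly.roots = f.charpoly.roots.map (· ^ j) := by
  have h : (f ^ j).charpoly =
      ((f.charpoly.roots.map (· ^ j)).map fun a => Polynomial.X - Polynomial.C a).prod := by
    refine Polynomial.funext fun c => ?_
    -- The value of the characteristic polynomial of `f ^ j` at `c` is the determinant of `c - f ^
    -- j`.
    have h1 := det_aeval_eq_prod_roots_charpoly f (Polynomial.C c - Polynomial.X ^ j)
    rw [LinearMap.eval_charpoly]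
    rw [Polynomial.eval_multiset_prod, Multiset.map_map, Multiset.map_map]
    simpa [Function.comp_def] using h1
  rw [h, Polynomial.roots_multiset_prod_X_sub_C]

theorem sum_roots_charpoly (f : Module.End k V) :
    f.charpoly.roots.sum = LinearMap.trace k V f :=
  (Module.End.trace_eq_sum_roots_charpoly_of_splits (IsAlgClosed.splits _)).symm

/-- In characteristic `p`, the trace of the `p ^ a`-th power is the `p ^ a`-th power of the
trace. -/
theorem trace_pow_char_pow (p : ℕ) [Fact p.Prime] [CharP k p] (f : Module.End k V) (a : ℕ) :
    LinearMap.trace k V (f ^ p ^ a) = LinearMap.trace k V f ^ p ^ a := by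
  rw [← sum_roots_charpoly, roots_charpoly_pow, ← sum_roots_charpoly, ← iterateFrobenius_def,
    map_multiset_sum]
  rfl

end Eigenvalues

/-- Two multisets with the same power sums are equal, in characteristic zero. -/
theorem multiset_eq_of_sum_pow_eq {K : Type*} [Field K] [CharZero K] (s t : Multiset K)
    (h : ∀ j : ℕ, (s.map (· ^ j)).sum = (t.map (· ^ j)).sum) : s = t := by
  classical
  have hq : ∀ q : Polynomial K, (s.map q.eval).sum = (t.map q.eval).sum := by
    intro q
    induction q using Polynomial.induction_on' with
    | add q r hq hr => simp only [Polynomial.eval_add, Multiset.sum_map_add, hq, hr]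
    | monomial n a => simp only [Polynomial.eval_monomial, Multiset.sum_map_mul_left, h]
  have hcount : ∀ u : Multiset K, ∀ z : K, ∀ q : Polynomial K, (∀ w ∈ u, w ≠ z → q.eval w = 0) →
      (u.map q.eval).sum = u.count z * q.eval z := by
    intro u z q
    induction u using Multiset.induction_on with
    | empty => simp
    | cons w u ih =>
      intro hu
      rw [Multiset.map_cons, Multiset.sum_cons, ih fun x hx => hu x (Multiset.mem_cons_of_mem hx)]
      by_cases hw : w = z
      · subst hw
        rw [Multiset.count_cons_self]
        push_cast
        ring
      · rw [hu w (Multiset.mem_cons_self _ _) hw, Multiset.count_cons_of_ne (Ne.symm hw), zero_add]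
  ext z
  -- An interpolation polynomial: summing its values over a multiset isolates the multiplicity of
  -- `z`, which characteristic zero recovers as a natural number.
  let q : Polynomial K := ∏ w ∈ (s + t).toFinset.erase z, (Polynomial.X - Polynomial.C w)
  have hq0 : ∀ w ∈ s + t, w ≠ z → q.eval w = 0 := by
    intro w hw hwz
    rw [Polynomial.eval_prod]
    exact Finset.prod_eq_zero (Finset.mem_erase.2 ⟨hwz, Multiset.mem_toFinset.2 hw⟩) (by simp)
  have hqz : q.eval z ≠ 0 := by
    rw [Polynomial.eval_prod, Finset.prod_ne_zero_iff]
    intro w hw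
    rw [Polynomial.eval_sub, Polynomial.eval_X, Polynomial.eval_C, sub_ne_zero]
    exact (Finset.ne_of_mem_erase hw).symm
  have h1 := hq q
  rw [hcount s z q fun w hw => hq0 w (Multiset.mem_add.2 (Or.inl hw)),
    hcount t z q fun w hw => hq0 w (Multiset.mem_add.2 (Or.inr hw))] at h1
  exact_mod_cast mul_right_cancel₀ hqz h1

theorem trace_lsmul_of_isIdempotentElem {k A V : Type*} [Field k] [Ring A] [Algebra k A]
    [AddCommGroup V] [Module k V] [Module A V] [IsScalarTower k A V] [FiniteDimensional k V]
    {e : A} (he : IsIdempotentElem e) :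
    LinearMap.trace k V (Algebra.lsmul k k V e) = idemDim k e V :=
  (LinearMap.IsIdempotentElem.isProj_range _ (he.map (Algebra.lsmul k k V))).trace

/-! ### Brauer characters determine simple modules -/

section RootLift

variable {p : ℕ} {k : Type u} {G : Type v} [Field k]

theorem RootLift.lift_val (θ : RootLift p k G) (ζ : rootsOfUnity (ordCompl[p] (Nat.card G)) k) :
    θ.lift ((ζ : kˣ) : k) = ((θ ζ : ℂˣ) : ℂ) := by
  refine Function.Injective.extend_apply (fun a b h => ?_) _ _ ζ
  exact Subtype.ext (Units.ext h)

theorem RootLift.exists_rootsOfUnity {x : k} (hm : ordCompl[p] (Nat.card G) ≠ 0)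
    (hx : x ^ (ordCompl[p] (Nat.card G)) = 1) :
    ∃ ζ : rootsOfUnity (ordCompl[p] (Nat.card G)) k, ((ζ : kˣ) : k) = x := by
  have : NeZero (ordCompl[p] (Nat.card G)) := ⟨hm⟩
  exact ⟨rootsOfUnity.mkOfPowEq x hx, rootsOfUnity.coe_mkOfPowEq hx⟩

theorem RootLift.lift_one (θ : RootLift p k G) : θ.lift (1 : k) = 1 := by
  have := θ.lift_val 1
  simpa using this

end RootLift

section Group

variable {p : ℕ} {k : Type u} {G : Type v} [Field k] [Group G]

theorem ordCompl_card_ne_zero [Finite G] : ordCompl[p] (Nat.card G) ≠ 0 :=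
  (Nat.ordCompl_pos p Nat.card_pos.ne').ne'

theorem PRegular.pow_ordCompl [Fact p.Prime] (g : PRegular p G) : (g : G) ^ (ordCompl[p] (Nat.card G)) = 1 := by
  rw [← orderOf_dvd_iff_pow_eq_one]
  have h1 : orderOf (g : G) ∣ p ^ (Nat.card G).factorization p * ordCompl[p] (Nat.card G) := by
    rw [Nat.ordProj_mul_ordCompl_eq_self]
    exact orderOf_dvd_natCard _
  refine Nat.Coprime.dvd_of_dvd_mul_left (Nat.Coprime.pow_right _ ?_) h1
  exact (((Fact.out : p.Prime).coprime_iff_not_dvd).2 g.2).symm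

theorem not_dvd_orderOf_pow (g : G) (j : ℕ) (hg : ¬ p ∣ orderOf g) : ¬ p ∣ orderOf (g ^ j) :=
  fun h => hg (h.trans (orderOf_pow_dvd j))

variable [Fact p.Prime]

theorem not_dvd_orderOf_pow_ordProj [Finite G] (g : G) :
    ¬ p ∣ orderOf (g ^ ordProj[p] (Nat.card G)) := by
  have h1 : orderOf (g ^ ordProj[p] (Nat.card G)) ∣ ordCompl[p] (Nat.card G) := by
    rw [orderOf_dvd_iff_pow_eq_one, ← pow_mul, Nat.ordProj_mul_ordCompl_eq_self, pow_card_eq_one']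
  exact fun h => Nat.not_dvd_ordCompl Fact.out Nat.card_pos.ne' (h.trans h1)

variable {V : Type*} [AddCommGroup V] [Module k V]
  [Module (MonoidAlgebra k G) V] [IsScalarTower k (MonoidAlgebra k G) V] [Module.Finite k V]

theorem brauerCharacter_one (θ : RootLift p k G) :
    brauerCharacter θ V 1 = Module.finrank k V := by
  unfold brauerCharacter
  have h : ((1 : PRegular p G) : G) = 1 := rfl
  rw [h, map_one, map_one, LinearMap.charpoly_one, ← Polynomial.C_1, Polynomial.roots_pow,
    Polynomial.roots_X_sub_C, Multiset.nsmul_singleton, Multiset.map_replicate, θ.lift_one,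
    Multiset.sum_replicate, nsmul_eq_mul, mul_one]

variable [IsAlgClosed k]

theorem pow_eq_one_of_mem_roots (g : PRegular p G) {x : k}
    (hx : x ∈ (Algebra.lsmul k k V (MonoidAlgebra.of k G (g : G))).charpoly.roots) :
    x ^ (ordCompl[p] (Nat.card G)) = 1 := by
  have h := roots_charpoly_pow (Algebra.lsmul k k V (MonoidAlgebra.of k G (g : G)))
    (ordCompl[p] (Nat.card G))
  rw [← map_pow, ← map_pow, g.pow_ordCompl, map_one, map_one, LinearMap.charpoly_one,
    ← Polynomial.C_1, Polynomial.roots_pow, Polynomial.roots_X_sub_C] at h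
  have hm := Multiset.mem_map_of_mem (· ^ (ordCompl[p] (Nat.card G))) hx
  rw [← h] at hm
  exact Multiset.mem_singleton.1 (Multiset.mem_of_mem_nsmul hm)

variable [Finite G]

/-- Eigenvalues of `p`-regular elements lie in the domain of `θ`, where `lift` is multiplicative.
Thus the Brauer character on the powers of `g` gives all power sums of the lifted eigenvalues. -/
theorem map_lift_roots_pow (θ : RootLift p k G) (g : PRegular p G) (j : ℕ) :
    ((Algebra.lsmul k k V (MonoidAlgebra.of k G ((g : G) ^ j))).charpoly.roots.map θ.lift) =
    ((Algebra.lsmul k k V (MonoidAlgebra.of k G (g : G))).charpoly.roots.map θ.lift).map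
      (· ^ j) := by
  rw [map_pow, map_pow, roots_charpoly_pow, Multiset.map_map, Multiset.map_map]
  refine Multiset.map_congr rfl fun x hx => ?_
  obtain ⟨ζ, rfl⟩ := RootLift.exists_rootsOfUnity ordCompl_card_ne_zero
    (pow_eq_one_of_mem_roots g hx)
  have h := θ.lift_val (ζ ^ j)
  simp only [map_pow, Function.comp_apply, Subgroup.coe_pow, Units.val_pow_eq_pow_val] at h ⊢
  rw [h, θ.lift_val]

variable {W : Type*} [AddCommGroup W] [Module k W]
  [Module (MonoidAlgebra k G) W] [IsScalarTower k (MonoidAlgebra k G) W] [Module.Finite k W]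

/-- The Brauer character determines the eigenvalues of `p`-regular elements. -/
theorem roots_charpoly_eq_of_brauerCharacter_eq (θ : RootLift p k G) (hθ : Function.Injective θ)
    (h : brauerCharacter θ V = brauerCharacter θ W) (g : PRegular p G) :
    (Algebra.lsmul k k V (MonoidAlgebra.of k G (g : G))).charpoly.roots =
    (Algebra.lsmul k k W (MonoidAlgebra.of k G (g : G))).charpoly.roots := by
  have hmap : (Algebra.lsmul k k V (MonoidAlgebra.of k G (g : G))).charpoly.roots.map θ.lift =
      (Algebra.lsmul k k W (MonoidAlgebra.of k G (g : G))).charpoly.roots.map θ.lift := by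
    refine multiset_eq_of_sum_pow_eq _ _ fun j => ?_
    have := congrFun h ⟨(g : G) ^ j, not_dvd_orderOf_pow _ j g.2⟩
    unfold brauerCharacter at this
    rwa [map_lift_roots_pow, map_lift_roots_pow] at this
  have hinj : Set.InjOn θ.lift {x | x ^ (ordCompl[p] (Nat.card G)) = 1} := by
    intro x hx y hy hxy
    obtain ⟨ζ, rfl⟩ := RootLift.exists_rootsOfUnity ordCompl_card_ne_zero hx
    obtain ⟨ξ, rfl⟩ := RootLift.exists_rootsOfUnity ordCompl_card_ne_zero hy
    rw [θ.lift_val, θ.lift_val] at hxy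
    rw [hθ (Units.ext hxy)]
  have hleft := hinj.leftInvOn_invFunOn
  have hid : ∀ s : Multiset k, (∀ x ∈ s, x ^ (ordCompl[p] (Nat.card G)) = 1) →
      (s.map θ.lift).map (Function.invFunOn θ.lift {x | x ^ (ordCompl[p] (Nat.card G)) = 1}) =
        s := by
    intro s hs
    rw [Multiset.map_map]
    conv_rhs => rw [← Multiset.map_id s]
    exact Multiset.map_congr rfl fun x hx => hleft (hs x hx)
  rw [← hid _ fun x hx => pow_eq_one_of_mem_roots g hx, hmap,
    hid _ fun x hx => pow_eq_one_of_mem_roots g hx]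

variable [CharP k p]

/-- The Brauer character determines the traces of all elements of the group algebra. -/
theorem trace_eq_of_brauerCharacter_eq (θ : RootLift p k G) (hθ : Function.Injective θ)
    (h : brauerCharacter θ V = brauerCharacter θ W) (a : MonoidAlgebra k G) :
    LinearMap.trace k V (Algebra.lsmul k k V a) = LinearMap.trace k W (Algebra.lsmul k k W a) := by
  induction a using MonoidAlgebra.induction_on with
  | of g =>
    -- Raising `g` to the `p`-part of `|G|` makes it `p`-regular and raises its trace to that power;
    -- the iterated Frobenius of `k` is injective.
    have h1 := congrArg Multiset.sum (roots_charpoly_eq_of_brauerCharacter_eq θ hθ h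
      ⟨g ^ ordProj[p] (Nat.card G), not_dvd_orderOf_pow_ordProj g⟩)
    simp only [sum_roots_charpoly, map_pow, trace_pow_char_pow p] at h1
    exact iterateFrobenius_inj k p ((Nat.card G).factorization p) h1
  | add a b ha hb => simp only [map_add, ha, hb]
  | smul r a ha => simp only [map_smul, ha]

/-- The generator of a principal indecomposable module does not annihilate the head. -/
theorem exists_span_eq_and_idemDim_ne_zero {k A V : Type*} [Field k] [Ring A] [Algebra k A]
    [AddCommGroup V] [Module k V] [Module A V] [IsScalarTower k A V] [FiniteDimensional k V]
    [IsSimpleModule A V] {P : Submodule A A} (hP : IsPrincipalIndecomposable P V) :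
    ∃ e : A, IsPrimitiveIdempotent e ∧ P = Submodule.span A {e} ∧ idemDim k e V ≠ 0 := by
  obtain ⟨⟨e, he, rfl⟩, f, hf⟩ := hP
  refine ⟨e, he, rfl, fun h => ?_⟩
  rw [idemDim_eq_zero_iff] at h
  have := IsSimpleModule.nontrivial A V
  obtain ⟨v, hv⟩ := exists_ne (0 : V)
  obtain ⟨⟨x, hx⟩, rfl⟩ := hf v
  obtain ⟨a, rfl⟩ := Submodule.mem_span_singleton.1 hx
  apply hv
  have h1 : (⟨a • e, hx⟩ : Submodule.span A {e}) =
      a • e • ⟨e, Submodule.mem_span_singleton_self e⟩ :=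
    Subtype.ext (by simp [he.idem.eq])
  rw [h1, map_smul, map_smul, h, smul_zero]

/-- Simple modules with the same Brauer character are isomorphic. -/
theorem nonempty_linearEquiv_of_brauerCharacter_eq [IsSimpleModule (MonoidAlgebra k G) V]
    [IsSimpleModule (MonoidAlgebra k G) W] (θ : RootLift p k G) (hθ : Function.Injective θ)
    (h : brauerCharacter θ V = brauerCharacter θ W) :
    Nonempty (V ≃ₗ[MonoidAlgebra k G] W) := by
  obtain ⟨P, hP⟩ := exists_isPrincipalIndecomposable (R := MonoidAlgebra k G) V
  obtain ⟨e, he, -, hV⟩ := exists_span_eq_and_idemDim_ne_zero (k := k) hP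
  -- The trace of `e` is `1` on `V`, so it is nonzero on `W`, and `e` does not kill `W`.
  have h1 := trace_eq_of_brauerCharacter_eq θ hθ h e
  rw [trace_lsmul_of_isIdempotentElem he.idem, trace_lsmul_of_isIdempotentElem he.idem,
    he.idemDim_eq_one hV] at h1
  refine he.nonempty_linearEquiv (fun h0 => ?_) hV
  rw [h0] at h1
  simp at h1

end Group

/-! ### Lifting idempotents of group algebras -/

section Lifting

theorem coeff_mul_eq_sum {R G : Type*} [Semiring R] [Group G] [Fintype G] (x y : MonoidAlgebra R G)
    (g : G) : (x * y).coeff g = ∑ h, x.coeff h * y.coeff (h⁻¹ * g) := by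
  classical
  rw [MonoidAlgebra.coeff_mul, Finsupp.sum_fintype _ _ (by simp)]
  refine Finset.sum_congr rfl fun h _ => ?_
  rw [Finsupp.sum_fintype _ _ (by simp), Finset.sum_eq_single (h⁻¹ * g)]
  · simp
  · intro b _ hb
    rw [if_neg]
    rintro rfl
    simp at hb
  · simp

variable {O : Type*} [CommRing O] {G : Type*} [Group G]

/-- The two-sided ideal of the elements of the group algebra with coefficients in `I`. -/
def coeffIdeal (I : Ideal O) (G : Type*) [Group G] : AddSubgroup (MonoidAlgebra O G) where
  carrier := {x | ∀ g, x.coeff g ∈ I}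
  zero_mem' := fun g => by simp
  add_mem' := fun {x y} hx hy g => by simpa using I.add_mem (hx g) (hy g)
  neg_mem' := fun {x} hx g => by simpa using hx g

theorem mem_coeffIdeal {I : Ideal O} {x : MonoidAlgebra O G} :
    x ∈ coeffIdeal I G ↔ ∀ g, x.coeff g ∈ I := Iff.rfl

theorem coeffIdeal_mono {I J : Ideal O} (h : I ≤ J) : coeffIdeal I G ≤ coeffIdeal J G :=
  fun _ hx g => h (hx g)

theorem eq_zero_of_forall_mem_coeffIdeal {I : Ideal O} [IsHausdorff I O] {x : MonoidAlgebra O G}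
    (hx : ∀ n, x ∈ coeffIdeal (I ^ n) G) : x = 0 := by
  ext g
  refine IsHausdorff.haus (I := I) inferInstance _ fun n => ?_
  rw [SModEq.sub_mem, smul_eq_mul, Ideal.mul_top, sub_zero]
  exact hx n g

theorem commute_single_iff {x : MonoidAlgebra O G} {g : G} :
    Commute (MonoidAlgebra.single g (1 : O)) x ↔ ∀ h, x.coeff (g * h * g⁻¹) = x.coeff h := by
  constructor
  · intro hc h
    have := congrArg (fun y => y.coeff (g * h)) hc.eq
    simp only [MonoidAlgebra.coeff_single_mul_mul, one_mul] at this
    rw [this]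
    conv_rhs => rw [← inv_mul_cancel_right (g * h) g]
    rw [MonoidAlgebra.coeff_mul_single_mul, mul_one]
  · intro hx
    ext h
    have h1 := MonoidAlgebra.coeff_single_mul_mul x (1 : O) g (g⁻¹ * h)
    have h2 := MonoidAlgebra.coeff_mul_single_mul x (1 : O) g (h * g⁻¹)
    rw [mul_inv_cancel_left, one_mul] at h1
    rw [inv_mul_cancel_right, mul_one] at h2
    rw [h1, h2, ← hx (g⁻¹ * h), mul_inv_cancel_left]

variable [Finite G]

theorem mul_mem_coeffIdeal {I J : Ideal O} {x y : MonoidAlgebra O G} (hx : x ∈ coeffIdeal I G)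
    (hy : y ∈ coeffIdeal J G) : x * y ∈ coeffIdeal (I * J) G := by
  have := Fintype.ofFinite G
  intro g
  rw [coeff_mul_eq_sum]
  exact Ideal.sum_mem _ fun h _ => Ideal.mul_mem_mul (hx h) (hy _)

theorem mul_mem_coeffIdeal_left {I : Ideal O} (x : MonoidAlgebra O G) {y : MonoidAlgebra O G}
    (hy : y ∈ coeffIdeal I G) : x * y ∈ coeffIdeal I G := by
  have h := mul_mem_coeffIdeal (I := ⊤) (x := x) (fun _ => Submodule.mem_top) hy
  rwa [Ideal.top_mul] at h

theorem mul_mem_coeffIdeal_right {I : Ideal O} {x : MonoidAlgebra O G} (y : MonoidAlgebra O G)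
    (hx : x ∈ coeffIdeal I G) : x * y ∈ coeffIdeal I G := by
  have h := mul_mem_coeffIdeal (J := ⊤) (y := y) hx (fun _ => Submodule.mem_top)
  rwa [Ideal.mul_top] at h

theorem exists_limit {I : Ideal O} [IsPrecomplete I O] (a : ℕ → MonoidAlgebra O G)
    (ha : ∀ n, a (n + 1) - a n ∈ coeffIdeal (I ^ n) G) :
    ∃ L, ∀ n, L - a n ∈ coeffIdeal (I ^ n) G := by
  have hle : ∀ {m n : ℕ}, m ≤ n → a n - a m ∈ coeffIdeal (I ^ m) G := by
    intro m n hmn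
    induction n, hmn using Nat.le_induction with
    | base => simp
    | succ n hmn ih =>
      rw [← sub_add_sub_cancel _ (a n)]
      exact add_mem (coeffIdeal_mono (Ideal.pow_le_pow_right hmn) (ha n)) ih
  have hlim : ∀ g : G, ∃ l : O, ∀ n, (a n).coeff g ≡ l [SMOD (I ^ n • ⊤ : Submodule O O)] := by
    intro g
    refine IsPrecomplete.prec' (fun n => (a n).coeff g) fun {m n} hmn => ?_
    rw [SModEq.comm, SModEq.sub_mem, smul_eq_mul, Ideal.mul_top]
    simpa using hle hmn g
  choose l hl using hlim
  refine ⟨MonoidAlgebra.ofCoeff (Finsupp.equivFunOnFinite.symm l), fun n g => ?_⟩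
  have := (hl g n).symm
  rw [SModEq.sub_mem, smul_eq_mul, Ideal.mul_top] at this
  simpa using this

/-- Idempotents of the group algebra lift modulo the ideal of an adically complete ring. -/
theorem exists_isIdempotentElem_sub_mem {I : Ideal O} [IsAdicComplete I O] (x : MonoidAlgebra O G)
    (hx : x * x - x ∈ coeffIdeal I G) : ∃ L : MonoidAlgebra O G, IsIdempotentElem L ∧
      L - x ∈ coeffIdeal I G ∧ ∀ c, Commute c x → Commute c L := by
  -- Newton iteration for `y ^ 2 = y`: the error `y * y - y` gets squared. The linear bound `I ^ (n
  -- + 1)` for the error after `n` steps is enough for convergence.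
  let f : MonoidAlgebra O G → MonoidAlgebra O G := fun y => 3 * (y * y) - 2 * (y * y * y)
  have hf1 : ∀ y, f y - y = (y * y - y) * (1 - 2 * y) := fun y => by
    simp only [f]; noncomm_ring
  have hf2 : ∀ y, f y * f y - f y = (y * y - y) * (y * y - y) * (4 * (y * y) - 4 * y - 3) :=
    fun y => by simp only [f]; noncomm_ring
  let a : ℕ → MonoidAlgebra O G := fun n => f^[n] x
  have ha : ∀ n, a (n + 1) = f (a n) := fun n => Function.iterate_succ_apply' f n x
  have hd : ∀ n, a n * a n - a n ∈ coeffIdeal (I ^ (n + 1)) G := by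
    intro n
    induction n with
    | zero => simpa [a] using hx
    | succ n ih =>
      rw [ha, hf2]
      refine mul_mem_coeffIdeal_right _ (coeffIdeal_mono ?_ (mul_mem_coeffIdeal ih ih))
      rw [← pow_add]
      exact Ideal.pow_le_pow_right (by omega)
  have hstep : ∀ n, a (n + 1) - a n ∈ coeffIdeal (I ^ (n + 1)) G := fun n => by
    rw [ha, hf1]
    exact mul_mem_coeffIdeal_right _ (hd n)
  obtain ⟨L, hL⟩ := exists_limit a fun n =>
    coeffIdeal_mono (Ideal.pow_le_pow_right (Nat.le_succ n)) (hstep n)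
  refine ⟨L, ?_, ?_, fun c hc => ?_⟩
  · refine sub_eq_zero.1 (eq_zero_of_forall_mem_coeffIdeal (I := I) fun n => ?_)
    have : L * L - L = (L - a n) * L + a n * (L - a n) - (L - a n) + (a n * a n - a n) := by
      noncomm_ring
    rw [this]
    exact add_mem (sub_mem (add_mem (mul_mem_coeffIdeal_right _ (hL n))
      (mul_mem_coeffIdeal_left _ (hL n))) (hL n))
      (coeffIdeal_mono (Ideal.pow_le_pow_right (Nat.le_succ n)) (hd n))
  · have h1 := hL 1
    have h2 := hstep 0
    rw [zero_add, pow_one] at h2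
    rw [pow_one] at h1
    have := add_mem h1 h2
    rwa [sub_add_sub_cancel] at this
  · have hca : ∀ n, Commute c (a n) := by
      intro n
      induction n with
      | zero => exact hc
      | succ n ih =>
        rw [ha]
        have h3 : Commute c (3 : MonoidAlgebra O G) := Commute.ofNat_right c 3
        have h2 : Commute c (2 : MonoidAlgebra O G) := Commute.ofNat_right c 2
        exact (h3.mul_right (ih.mul_right ih)).sub_right
          (h2.mul_right ((ih.mul_right ih).mul_right ih))
    refine sub_eq_zero.1 (eq_zero_of_forall_mem_coeffIdeal (I := I) fun n => ?_)
    have : c * L - L * c = c * (L - a n) - (L - a n) * c := by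
      rw [mul_sub, sub_mul, (hca n).eq]; abel
    rw [this]
    exact sub_mem (mul_mem_coeffIdeal_left _ (hL n)) (mul_mem_coeffIdeal_right _ (hL n))

variable {k : Type*} [CommRing k]

theorem exists_isIdempotentElem_map_eq {I : Ideal O} [IsAdicComplete I O] (π : O →+* k)
    (hπ : Function.Surjective π) (hker : RingHom.ker π = I) {e : MonoidAlgebra k G}
    (he : IsIdempotentElem e) :
    ∃ E : MonoidAlgebra O G, IsIdempotentElem E ∧ MonoidAlgebra.mapRingHom G π E = e ∧
      ((∀ g h : G, e.coeff (g * h * g⁻¹) = e.coeff h) →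
        ∀ g h : G, E.coeff (g * h * g⁻¹) = E.coeff h) := by
  have hmem : ∀ x : MonoidAlgebra O G,
      x ∈ coeffIdeal I G ↔ MonoidAlgebra.mapRingHom G π x = 0 := by
    intro x
    rw [mem_coeffIdeal, ← MonoidAlgebra.coeff_eq_zero, Finsupp.ext_iff]
    refine forall_congr' fun g => ?_
    rw [← hker, RingHom.mem_ker]
    simp
  -- One preimage is chosen for each value of a coefficient, so `x` inherits invariance under
  -- conjugation from `e`, and the iteration preserves it as commutation with group elements.
  let x : MonoidAlgebra O G := MonoidAlgebra.ofCoeff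
    (Finsupp.equivFunOnFinite.symm fun g => Function.surjInv hπ (e.coeff g))
  have hx : MonoidAlgebra.mapRingHom G π x = e := by
    ext g
    simp [x, Function.surjInv_eq]
  obtain ⟨E, hE, hsub, hcomm⟩ := exists_isIdempotentElem_sub_mem (I := I) x (by
    rw [hmem, map_sub, map_mul, hx, he.eq, sub_self])
  refine ⟨E, hE, ?_, fun hconj g => commute_single_iff.1 (hcomm _ (commute_single_iff.2 ?_))⟩
  · rw [hmem, map_sub, hx, sub_eq_zero] at hsub
    exact hsub
  · intro h
    simp [x, hconj]

end Lifting

/-! ### The maps `x ↦ a x b` -/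

section Sandwich

/-- The linear map `x ↦ a x b`. -/
def sandwich (R : Type*) {A : Type*} [CommRing R] [Ring A] [Algebra R A] (a b : A) : A →ₗ[R] A :=
  LinearMap.mulLeft R a ∘ₗ LinearMap.mulRight R b

theorem sandwich_apply {R A : Type*} [CommRing R] [Ring A] [Algebra R A] (a b x : A) :
    sandwich R a b x = a * (x * b) := rfl

theorem isIdempotentElem_sandwich {R A : Type*} [CommRing R] [Ring A] [Algebra R A] {a b : A}
    (ha : IsIdempotentElem a) (hb : IsIdempotentElem b) :
    IsIdempotentElem (sandwich R a b : Module.End R A) := by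
  refine LinearMap.ext fun x => ?_
  rw [Module.End.mul_apply, sandwich_apply, sandwich_apply, mul_assoc, mul_assoc, hb.eq,
    ← mul_assoc a a, ha.eq]

/-- The dimension of `e A f`. -/
def peirceDim (k : Type*) {A : Type*} [Field k] [Ring A] [Algebra k A] (e f : A) : ℕ :=
  Module.finrank k (LinearMap.range (sandwich k e f))

theorem trace_sandwich {k A : Type*} [Field k] [Ring A] [Algebra k A] [FiniteDimensional k A]
    {e f : A} (he : IsIdempotentElem e) (hf : IsIdempotentElem f) :
    LinearMap.trace k A (sandwich k e f) = peirceDim k e f :=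
  (LinearMap.IsIdempotentElem.isProj_range _ (isIdempotentElem_sandwich he hf)).trace

theorem charpoly_of_isIdempotentElem {k V : Type*} [Field k] [AddCommGroup V] [Module k V]
    [FiniteDimensional k V] {f : Module.End k V} (hf : IsIdempotentElem f) :
    f.charpoly = (Polynomial.X - Polynomial.C 1) ^ Module.finrank k (LinearMap.range f) *
      (Polynomial.X - Polynomial.C 0) ^ Module.finrank k (LinearMap.ker f) := by
  rw [(LinearMap.IsIdempotentElem.isProj_range _ hf).eq_conj_prodMap, LinearEquiv.charpoly_conj,
    LinearMap.charpoly_prodMap]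
  have h1 : (LinearMap.id : LinearMap.range f →ₗ[k] LinearMap.range f).charpoly =
      (Polynomial.X - 1) ^ Module.finrank k (LinearMap.range f) := LinearMap.charpoly_one
  rw [h1, LinearMap.charpoly_zero, ← (LinearMap.IsIdempotentElem.isProj_range _ hf).eq_conj_prodMap]
  simp

variable {O : Type*} [CommRing O] {G : Type*} [Group G]

theorem toMatrix_sandwich_map [Fintype G] [DecidableEq G] {S : Type*} [CommRing S] (φ : O →+* S)
    (a b : MonoidAlgebra O G) :
    LinearMap.toMatrix (MonoidAlgebra.basis G S) (MonoidAlgebra.basis G S)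
      (sandwich S (MonoidAlgebra.mapRingHom G φ a) (MonoidAlgebra.mapRingHom G φ b)) =
    (LinearMap.toMatrix (MonoidAlgebra.basis G O) (MonoidAlgebra.basis G O)
      (sandwich O a b)).map φ := by
  ext x y
  rw [Matrix.map_apply, LinearMap.toMatrix_apply, LinearMap.toMatrix_apply]
  change MonoidAlgebra.coeff (sandwich S _ _ _) x = φ (MonoidAlgebra.coeff (sandwich O _ _ _) x)
  rw [← MonoidAlgebra.coeff_mapRingHom, sandwich_apply, sandwich_apply, map_mul, map_mul,
    MonoidAlgebra.basis_apply, MonoidAlgebra.basis_apply, MonoidAlgebra.mapRingHom_single, map_one]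

/-- The dimension of `e A f` does not change under reduction. -/
theorem peirceDim_mapRingHom_eq [Finite G] {k L : Type*} [Field k] [Field L] (π : O →+* k)
    (ι : O →+* L) (hι : Function.Injective ι) {E F : MonoidAlgebra O G} (hE : IsIdempotentElem E)
    (hF : IsIdempotentElem F) :
    peirceDim k (MonoidAlgebra.mapRingHom G π E) (MonoidAlgebra.mapRingHom G π F) =
    peirceDim L (MonoidAlgebra.mapRingHom G ι E) (MonoidAlgebra.mapRingHom G ι F) := by
  classical
  have := Fintype.ofFinite G
  let M := LinearMap.toMatrix (MonoidAlgebra.basis G O) (MonoidAlgebra.basis G O) (sandwich O E F)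
  have hk := charpoly_of_isIdempotentElem (isIdempotentElem_sandwich (R := k)
    (hE.map (MonoidAlgebra.mapRingHom G π)) (hF.map (MonoidAlgebra.mapRingHom G π)))
  have hL := charpoly_of_isIdempotentElem (isIdempotentElem_sandwich (R := L)
    (hE.map (MonoidAlgebra.mapRingHom G ι)) (hF.map (MonoidAlgebra.mapRingHom G ι)))
  rw [← LinearMap.charpoly_toMatrix _ (MonoidAlgebra.basis G _), toMatrix_sandwich_map,
    Matrix.charpoly_map] at hk hL
  -- Over `L` the characteristic polynomial is `(X - 1) ^ a * X ^ b`. By injectivity of `ι` this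
  -- holds over `O`, hence over `k`, where the multiplicity of the root `1` is again the rank.
  have hO : M.charpoly = (Polynomial.X - Polynomial.C 1) ^
        peirceDim L (MonoidAlgebra.mapRingHom G ι E) (MonoidAlgebra.mapRingHom G ι F) *
      (Polynomial.X - Polynomial.C 0) ^ Module.finrank L (LinearMap.ker (sandwich L
        (MonoidAlgebra.mapRingHom G ι E) (MonoidAlgebra.mapRingHom G ι F))) := by
    apply Polynomial.map_injective ι hι
    rw [hL]
    simp [peirceDim]
  change Polynomial.map π M.charpoly = _ at hk
  rw [hO] at hk
  have h1 := congrArg (Polynomial.rootMultiplicity 1) hk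
  have hX : ∀ m n : ℕ, Polynomial.rootMultiplicity (1 : k)
      ((Polynomial.X - Polynomial.C 1) ^ m * (Polynomial.X - Polynomial.C 0) ^ n) = m := by
    intro m n
    rw [Polynomial.rootMultiplicity_mul (mul_ne_zero (pow_ne_zero _ (Polynomial.X_sub_C_ne_zero _))
      (pow_ne_zero _ (Polynomial.X_sub_C_ne_zero _))), Polynomial.rootMultiplicity_X_sub_C_pow,
      Polynomial.rootMultiplicity_eq_zero (by simp [Polynomial.IsRoot]), add_zero]
  simp only [Polynomial.map_mul, Polynomial.map_pow, Polynomial.map_sub, Polynomial.map_X,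
    Polynomial.map_C] at h1
  rw [map_one π, map_zero π, hX] at h1
  exact (hX _ _).symm.trans h1.symm

/-- The trace of `x ↦ a x g`. -/
theorem trace_sandwich_single [Fintype G] (a : MonoidAlgebra O G) (g : G) :
    LinearMap.trace O _ (sandwich O a (MonoidAlgebra.single g 1)) =
      ∑ x, a.coeff (x * g⁻¹ * x⁻¹) := by
  classical
  rw [LinearMap.trace_eq_matrix_trace O (MonoidAlgebra.basis G O), Matrix.trace]
  refine Finset.sum_congr rfl fun x _ => ?_
  rw [Matrix.diag_apply, LinearMap.toMatrix_apply]
  change MonoidAlgebra.coeff (sandwich O _ _ _) x = _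
  have h := MonoidAlgebra.coeff_mul_single_mul a (1 : O) (x * g) (x * g⁻¹ * x⁻¹)
  rw [sandwich_apply, MonoidAlgebra.basis_apply, MonoidAlgebra.single_mul_single, mul_one]
  rw [mul_one] at h
  rw [← h]
  congr 1
  group

end Sandwich

/-! ### Characters of the group algebra in characteristic zero -/

section Characters

/-- In the basis of matrix units, the diagonal coefficient at the unit `(x, y)` of block `i` is `a i
x x * b i y y`, and the double sum factors. -/
theorem trace_sandwich_pi_matrix {L : Type*} [Field L] {n : ℕ} {d : Fin n → ℕ}
    (a b : (i : Fin n) → Matrix (Fin (d i)) (Fin (d i)) L) :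
    LinearMap.trace L _ (sandwich L a b) = ∑ i, (a i).trace * (b i).trace := by
  classical
  rw [LinearMap.trace_eq_matrix_trace L
    (Pi.basis fun i => Matrix.stdBasis L (Fin (d i)) (Fin (d i))), Matrix.trace,
    Fintype.sum_sigma]
  refine Finset.sum_congr rfl fun i _ => ?_
  rw [Matrix.trace, Matrix.trace, Finset.sum_mul_sum, Fintype.sum_prod_type]
  refine Finset.sum_congr rfl fun x _ => Finset.sum_congr rfl fun y _ => ?_
  rw [Matrix.diag_apply, LinearMap.toMatrix_apply, Pi.basis_repr, Pi.basis_apply,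
    Matrix.stdBasis_eq_single]
  change (sandwich L a b (Pi.single i (Matrix.single x y 1)) i) x y = _
  rw [sandwich_apply, Pi.mul_apply, Pi.mul_apply, Pi.single_eq_same]
  simp [Matrix.mul_apply, Matrix.single_apply, ite_and]

theorem exists_natCast_eq_trace {L : Type*} [Field L] {d : ℕ} {e : Matrix (Fin d) (Fin d) L}
    (he : IsIdempotentElem e) : ∃ m : ℕ, e.trace = m := by
  have h := (LinearMap.IsIdempotentElem.isProj_range _ (he.map Matrix.toLinAlgEquiv')).trace
  refine ⟨_, Eq.trans ?_ h⟩
  rw [Matrix.toLinAlgEquiv']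
  exact (Matrix.trace_toLin'_eq e).symm

/-- The irreducible characters of a semisimple algebra: the trace of `x ↦ a x b` is the sum of the
products of the character values. -/
theorem exists_characters (L A : Type*) [Field L] [IsAlgClosed L] [Ring A] [Algebra L A]
    [FiniteDimensional L A] [IsSemisimpleRing A] :
    ∃ (n : ℕ) (χ : Fin n → A →ₗ[L] L),
      (∀ a b, LinearMap.trace L A (sandwich L a b) = ∑ i, χ i a * χ i b) ∧
      ∀ e, IsIdempotentElem e → ∀ i, ∃ m : ℕ, χ i e = m := by
  -- Wedderburn: the characters are the traces of the matrix components, and the trace of an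
  -- idempotent matrix is its rank.
  obtain ⟨n, d, -, ⟨α⟩⟩ := IsSemisimpleRing.exists_algEquiv_pi_matrix_of_isAlgClosed L A
  refine ⟨n, fun i => Matrix.traceLinearMap _ L L ∘ₗ LinearMap.proj i ∘ₗ α.toLinearMap, ?_, ?_⟩
  · intro a b
    have h : α.toLinearEquiv.conj (sandwich L a b) = sandwich L (α a) (α b) := by
      refine LinearMap.ext fun x => ?_
      simp [LinearEquiv.conj_apply, sandwich_apply]
    rw [← LinearMap.trace_conj' _ α.toLinearEquiv, h, trace_sandwich_pi_matrix]
    rfl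
  · intro e he i
    exact exists_natCast_eq_trace (congrFun (he.map α) i)

end Characters

/-! ### Class sums -/

section ClassSum

variable {G : Type*} [Group G]

open Classical in
/-- The sum of the coefficients over the conjugacy class of `g`. -/
def classSum {R : Type*} [CommRing R] [Fintype G] (a : MonoidAlgebra R G) (g : G) : R :=
  ∑ h with IsConj g h, a.coeff h

theorem card_conj_eq [Fintype G] [DecidableEq G] {g h : G} (hgh : IsConj g h) :
    Finset.card {x : G | x * g * x⁻¹ = h} = Nat.card (Subgroup.centralizer {g}) := by
  obtain ⟨y, rfl⟩ := isConj_iff.1 hgh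
  rw [← Fintype.card_subtype, ← Nat.card_eq_fintype_card]
  refine Nat.card_congr ⟨fun x => ⟨y⁻¹ * x.1, ?_⟩, fun c => ⟨y * c.1, ?_⟩, fun x => ?_,
    fun c => ?_⟩
  · rw [Subgroup.mem_centralizer_singleton_iff]
    have := x.2
    rw [mul_inv_eq_iff_eq_mul] at this
    rw [mul_assoc, this]
    group
  · have := Subgroup.mem_centralizer_singleton_iff.1 c.2
    rw [mul_inv_rev, mul_assoc y, this]
    group
  · exact Subtype.ext (mul_inv_cancel_left _ _)
  · exact Subtype.ext (inv_mul_cancel_left _ _)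

theorem sum_conj_eq_card_mul_classSum {R : Type*} [CommRing R] [Fintype G]
    (a : MonoidAlgebra R G) (g : G) :
    ∑ x, a.coeff (x * g * x⁻¹) = Nat.card (Subgroup.centralizer {g}) * classSum a g := by
  classical
  rw [← Finset.sum_fiberwise Finset.univ (fun x => x * g * x⁻¹), classSum, Finset.mul_sum,
    Finset.sum_filter]
  refine Finset.sum_congr rfl fun h _ => ?_
  rw [Finset.sum_congr rfl fun x hx => by rw [(Finset.mem_filter.1 hx).2], Finset.sum_const]
  split_ifs with hgh
  · rw [card_conj_eq hgh, nsmul_eq_mul]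
  · rw [Finset.filter_eq_empty_iff.2, Finset.card_empty, zero_smul]
    exact fun x _ hx => hgh (isConj_iff.2 ⟨x, hx⟩)

theorem classSum_mapRingHom {R S : Type*} [CommRing R] [CommRing S] [Fintype G] (φ : R →+* S)
    (a : MonoidAlgebra R G) (g : G) :
    classSum (MonoidAlgebra.mapRingHom G φ a) g = φ (classSum a g) := by
  simp [classSum]

/-- An element with vanishing class sums has trace zero on every module. -/
theorem trace_eq_zero_of_classSum_eq_zero {k : Type*} [Field k] [Fintype G] {V : Type*}
    [AddCommGroup V] [Module k V] [Module (MonoidAlgebra k G) V]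
    [IsScalarTower k (MonoidAlgebra k G) V] (a : MonoidAlgebra k G)
    (ha : ∀ g, classSum a g = 0) : LinearMap.trace k V (Algebra.lsmul k k V a) = 0 := by
  classical
  let τ : G → k := fun g => LinearMap.trace k V (Algebra.lsmul k k V (MonoidAlgebra.single g (1 : k)))
  have hτ : ∀ g h, IsConj g h → τ h = τ g := by
    intro g h hgh
    obtain ⟨c, rfl⟩ := isConj_iff.1 hgh
    have h1 : MonoidAlgebra.single (c * g * c⁻¹) (1 : k) =
        MonoidAlgebra.single c 1 * MonoidAlgebra.single g 1 * MonoidAlgebra.single c⁻¹ 1 := by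
      simp [MonoidAlgebra.single_mul_single]
    simp only [τ]
    rw [h1, map_mul, LinearMap.trace_mul_comm, ← map_mul, ← mul_assoc,
      MonoidAlgebra.single_mul_single, inv_mul_cancel, one_mul, ← MonoidAlgebra.one_def, one_mul]
  have hsum : a = ∑ h, a.coeff h • MonoidAlgebra.single h (1 : k) := by
    ext g
    simp
  have htr : LinearMap.trace k V (Algebra.lsmul k k V a) = ∑ h, a.coeff h * τ h := by
    conv_lhs => rw [hsum]
    simp only [τ, map_sum, map_smul, smul_eq_mul]
  -- The trace is a class function on `G`, so on the group algebra it depends only on the class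
  -- sums.
  rw [htr, ← Finset.sum_fiberwise Finset.univ ConjClasses.mk]
  refine Finset.sum_eq_zero fun c _ => ?_
  obtain ⟨g, rfl⟩ := ConjClasses.exists_rep c
  have hc : ∀ h, ConjClasses.mk h = ConjClasses.mk g ↔ IsConj g h := fun h => by
    rw [ConjClasses.mk_eq_mk_iff_isConj, isConj_comm]
  have h2 := ha g
  rw [classSum] at h2
  rw [Finset.sum_congr rfl fun h hh => by rw [hτ g h ((hc h).1 (Finset.mem_filter.1 hh).2)],
    ← Finset.sum_mul]
  simp only [hc]
  rw [h2, zero_mul]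

end ClassSum

/-! ### Defect groups -/

section Defect

variable {k : Type u} {G : Type v} [Field k] [Group G]

local notation "δ" => MonoidAlgebra.of k G

theorem mem_center_iff_forall_of {x : MonoidAlgebra k G} :
    x ∈ Set.center (MonoidAlgebra k G) ↔ ∀ g, Commute (δ g) x := by
  rw [Semigroup.mem_center_iff]
  refine ⟨fun h g => h _, fun h y => ?_⟩
  induction y using MonoidAlgebra.induction_on with
  | of g => exact h g
  | add a b ha hb => rw [add_mul, mul_add, ha, hb]
  | smul r a ha => rw [smul_mul_assoc, mul_smul_comm, ha]

theorem of_conj_eq_of_mem {Q : Subgroup G} {b : MonoidAlgebra k G}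
    (hb : ∀ q ∈ Q, δ q * b = b * δ q) {x y : G} (h : x⁻¹ * y ∈ Q) :
    δ x * b * δ x⁻¹ = δ y * b * δ y⁻¹ := by
  obtain ⟨q, rfl⟩ : ∃ q, y = x * q := ⟨x⁻¹ * y, by group⟩
  rw [inv_mul_cancel_left] at h
  have h1 : δ q * b * δ q⁻¹ = b := by
    rw [hb _ h, mul_assoc, ← map_mul, mul_inv_cancel, map_one, mul_one]
  rw [mul_inv_rev, map_mul, map_mul]
  conv_lhs => rw [← h1]
  simp only [mul_assoc]

theorem relativeTrace_eq_sum (Q : Subgroup G) [Fintype (G ⧸ Q)] (b : MonoidAlgebra k G) :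
    relativeTrace Q b = ∑ x : G ⧸ Q, δ x.out * b * δ x.out⁻¹ :=
  finsum_eq_sum_of_fintype _

variable [Finite G]

theorem relativeTrace_mem_center {Q : Subgroup G} {b : MonoidAlgebra k G}
    (hb : ∀ q ∈ Q, δ q * b = b * δ q) :
    relativeTrace Q b ∈ Set.center (MonoidAlgebra k G) := by
  have := Fintype.ofFinite (G ⧸ Q)
  rw [mem_center_iff_forall_of]
  intro g
  have h : δ g * relativeTrace Q b * δ g⁻¹ = relativeTrace Q b := by
    rw [relativeTrace_eq_sum, Finset.mul_sum, Finset.sum_mul]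
    refine Fintype.sum_equiv (MulAction.toPerm g) _ _ fun x => ?_
    have h1 : δ g * (δ x.out * b * δ x.out⁻¹) * δ g⁻¹ = δ (g * x.out) * b * δ (g * x.out)⁻¹ := by
      rw [mul_inv_rev, map_mul, map_mul]
      simp only [mul_assoc]
    rw [h1]
    refine of_conj_eq_of_mem hb ?_
    rw [← QuotientGroup.eq, QuotientGroup.out_eq', MulAction.toPerm_apply]
    conv_rhs => rw [← QuotientGroup.out_eq' x]
    rfl
  rw [Commute, SemiconjBy]
  conv_rhs => rw [← h]
  rw [mul_assoc, ← map_mul, inv_mul_cancel, map_one, mul_one]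

theorem relativeTrace_mul {Q : Subgroup G} (b : MonoidAlgebra k G) {z : MonoidAlgebra k G}
    (hz : z ∈ Set.center (MonoidAlgebra k G)) :
    relativeTrace Q b * z = relativeTrace Q (b * z) := by
  have := Fintype.ofFinite (G ⧸ Q)
  rw [relativeTrace_eq_sum, relativeTrace_eq_sum, Finset.sum_mul]
  refine Finset.sum_congr rfl fun x _ => ?_
  rw [mul_assoc, ((mem_center_iff_forall_of.1 hz) x.out⁻¹).eq]
  simp only [mul_assoc]

theorem relativeTrace_smul {Q : Subgroup G} (c : k) (b : MonoidAlgebra k G) :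
    relativeTrace Q (c • b) = c • relativeTrace Q b := by
  have := Fintype.ofFinite (G ⧸ Q)
  rw [relativeTrace_eq_sum, relativeTrace_eq_sum, Finset.smul_sum]
  refine Finset.sum_congr rfl fun x _ => ?_
  rw [mul_smul_comm, smul_mul_assoc]

theorem relativeTrace_sum {Q : Subgroup G} {ι : Type*} (s : Finset ι)
    (b : ι → MonoidAlgebra k G) :
    relativeTrace Q (∑ i ∈ s, b i) = ∑ i ∈ s, relativeTrace Q (b i) := by
  have := Fintype.ofFinite (G ⧸ Q)
  simp only [relativeTrace_eq_sum]
  rw [Finset.sum_comm]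
  refine Finset.sum_congr rfl fun x _ => ?_
  rw [Finset.mul_sum, Finset.sum_mul]

/-- Transitivity of the relative trace. -/
theorem relativeTrace_eq_relativeTrace_sum {Q D : Subgroup G} (hQD : Q ≤ D)
    [Fintype (D ⧸ Q.subgroupOf D)] {b : MonoidAlgebra k G} (hb : ∀ q ∈ Q, δ q * b = b * δ q) :
    relativeTrace Q b = relativeTrace D
      (∑ d : D ⧸ Q.subgroupOf D, δ (d.out : D) * b * δ ((d.out : D) : G)⁻¹) := by
  have := Fintype.ofFinite (G ⧸ Q)
  have := Fintype.ofFinite (G ⧸ D)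
  rw [relativeTrace_eq_sum, relativeTrace_eq_sum,
    ← (Subgroup.quotientEquivProdOfLE hQD).symm.sum_comp, Fintype.sum_prod_type]
  refine Finset.sum_congr rfl fun z _ => ?_
  rw [Finset.mul_sum, Finset.sum_mul]
  refine Finset.sum_congr rfl fun d _ => ?_
  have h1 : δ z.out * (δ ((d.out : D) : G) * b * δ ((d.out : D) : G)⁻¹) * δ z.out⁻¹ =
      δ (z.out * (d.out : D)) * b * δ (z.out * (d.out : D))⁻¹ := by
    rw [mul_inv_rev, map_mul, map_mul]
    simp only [mul_assoc]
  rw [h1]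
  refine of_conj_eq_of_mem hb ?_
  rw [← QuotientGroup.eq, QuotientGroup.out_eq']
  conv_lhs => rw [← QuotientGroup.out_eq' d]
  rfl

/-- Conjugacy under the elements of `D`. -/
def conjSetoid (D : Subgroup G) : Setoid G where
  r x y := ∃ d ∈ D, d * x * d⁻¹ = y
  iseqv := ⟨fun x => ⟨1, D.one_mem, by group⟩,
    fun {x y} ⟨d, hd, h⟩ => ⟨d⁻¹, D.inv_mem hd, by rw [← h]; group⟩,
    fun {x y z} ⟨d, hd, h⟩ ⟨c, hc, h'⟩ => ⟨c * d, D.mul_mem hc hd, by rw [← h', ← h]; group⟩⟩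

/-- An element whose coefficients are invariant under conjugation by `D` is a combination of the
sums over `D`-conjugacy classes. -/
theorem exists_eq_sum_conj (D : Subgroup G)
    [∀ y : G, Fintype (D ⧸ (Subgroup.centralizer {y} ⊓ D).subgroupOf D)]
    {x : MonoidAlgebra k G} (hx : ∀ d ∈ D, ∀ h, x.coeff (d * h * d⁻¹) = x.coeff h) :
    ∃ T : Finset G, x = ∑ y ∈ T, x.coeff y •
      ∑ d : D ⧸ (Subgroup.centralizer {y} ⊓ D).subgroupOf D,
        δ (d.out : D) * δ y * δ ((d.out : D) : G)⁻¹ := by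
  classical
  have := Fintype.ofFinite G
  let _ := conjSetoid D
  let r : G → G := fun g => (⟦g⟧ : Quotient (conjSetoid D)).out
  have hr : ∀ g, ∃ d ∈ D, d * r g * d⁻¹ = g := fun g => Quotient.mk_out (s := conjSetoid D) g
  have hrr : ∀ g, ∀ d ∈ D, r (d * g * d⁻¹) = r g := fun g d hd =>
    congrArg Quotient.out (Quotient.sound (s := conjSetoid D) ((conjSetoid D).symm ⟨d, hd, rfl⟩))
  have hr2 : ∀ g, r (r g) = r g := fun g => by
    obtain ⟨d, hd, h⟩ := hr g
    rw [← hrr (r g) d hd, h]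
  refine ⟨Finset.univ.image r, ?_⟩
  have hsum : x = ∑ h, x.coeff h • δ h := by
    ext g
    simp
  conv_lhs => rw [hsum]
  rw [← Finset.sum_fiberwise_of_maps_to (s := Finset.univ) (t := Finset.univ.image r) (g := r)
    fun g _ => Finset.mem_image_of_mem _ (Finset.mem_univ g)]
  refine Finset.sum_congr rfl fun y hy => ?_
  obtain ⟨y, -, rfl⟩ := Finset.mem_image.1 hy
  rw [Finset.smul_sum]
  symm
  -- Orbit and stabilizer: the cosets in `D` of the centralizer of `r y` correspond to the
  -- `D`-conjugates of `r y`.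
  refine Finset.sum_bij (fun d _ => ((d.out : D) : G) * r y * ((d.out : D) : G)⁻¹) ?_ ?_ ?_ ?_
  · intro d _
    rw [Finset.mem_filter]
    exact ⟨Finset.mem_univ _, by rw [hrr _ _ (d.out : D).2, hr2]⟩
  · intro c _ d _ hcd
    rw [← QuotientGroup.out_eq' c, ← QuotientGroup.out_eq' d, QuotientGroup.eq,
      Subgroup.mem_subgroupOf]
    refine ⟨Subgroup.mem_centralizer_singleton_iff.2 ?_, SetLike.coe_mem _⟩
    have h1 : ((c.out : D) : G)⁻¹ * (((c.out : D) : G) * r y * ((c.out : D) : G)⁻¹) *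
        ((d.out : D) : G) = ((c.out : D) : G)⁻¹ * (((d.out : D) : G) * r y * ((d.out : D) : G)⁻¹) *
        ((d.out : D) : G) := by rw [hcd]
    simp only [Subgroup.coe_mul, Subgroup.coe_inv]
    simp only [mul_assoc, inv_mul_cancel_left, inv_mul_cancel, mul_one] at h1 ⊢
    exact h1.symm
  · intro g hg
    have hgy : r g = r y := (Finset.mem_filter.1 hg).2
    obtain ⟨d, hd, h⟩ := hr g
    refine ⟨QuotientGroup.mk ⟨d, hd⟩, Finset.mem_univ _, ?_⟩
    obtain ⟨⟨q, hq⟩, hqd⟩ := QuotientGroup.mk_out_eq_mul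
      ((Subgroup.centralizer {r y} ⊓ D).subgroupOf D) ⟨d, hd⟩
    have hq1 := Subgroup.mem_centralizer_singleton_iff.1 (Subgroup.mem_subgroupOf.1 hq).1
    rw [hqd, ← h, hgy]
    simp only [Subgroup.coe_mul]
    rw [mul_inv_rev, mul_assoc d, hq1]
    group
  · intro d _
    rw [hx _ (d.out : D).2, map_mul, map_mul]

/-- A defect group centralizes some element of the support of the block idempotent. -/
theorem Block.exists_coeff_ne_zero_of_isDefectGroup (B : Block k G) {D : Subgroup G}
    (hD : B.IsDefectGroup D) :
    ∃ y : G, B.idem.coeff y ≠ 0 ∧ D ≤ Subgroup.centralizer {y} := by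
  classical
  have := fun y : G => Fintype.ofFinite (D ⧸ (Subgroup.centralizer {y} ⊓ D).subgroupOf D)
  obtain ⟨⟨a, ha, htr⟩, hmin⟩ := hD
  have hcen := B.isBlockIdempotent.central
  obtain ⟨T, hT⟩ := exists_eq_sum_conj D (x := B.idem) fun d _ =>
    commute_single_iff.1 (mem_center_iff_forall_of.1 hcen d)
  have hfix : ∀ y : G, ∀ q ∈ Subgroup.centralizer {y} ⊓ D, δ q * (a * δ y) = a * δ y * δ q := by
    rintro y q ⟨hq, hqD⟩
    rw [← mul_assoc, ha q hqD, mul_assoc, mul_assoc, ← map_mul, ← map_mul,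
      Subgroup.mem_centralizer_singleton_iff.1 hq]
  -- If the block idempotent `b` is the trace of `a` from `D`, it is also the trace of `a * b`.
  -- Expanding `b` into `D`-class sums, each a trace from `C_D(y)` to `D`, transitivity turns the
  -- summands into traces from `C_D(y)` to `G`.
  have hsum : ∑ y ∈ T, B.idem.coeff y •
      relativeTrace (Subgroup.centralizer {y} ⊓ D) (a * δ y) = B.idem := by
    have h1 : relativeTrace D (a * B.idem) = B.idem := by
      rw [← relativeTrace_mul a hcen, htr, B.isBlockIdempotent.idem.eq]
    refine Eq.trans ?_ h1
    conv_rhs => rw [hT, Finset.mul_sum, relativeTrace_sum]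
    refine Finset.sum_congr rfl fun y _ => ?_
    rw [relativeTrace_eq_relativeTrace_sum inf_le_right (hfix y), mul_smul_comm,
      relativeTrace_smul]
    congr 2
    rw [Finset.mul_sum]
    refine Finset.sum_congr rfl fun d _ => ?_
    rw [← mul_assoc, ← mul_assoc, ← mul_assoc, ha _ (d.out : D).2]
  -- By Rosenberg's lemma one summand divides the block idempotent, which is then itself a trace
  -- from `C_D(y)`; minimality of `D` yields `D ≤ C_D(y)`.
  obtain ⟨y, hyT, w, hw, hyw⟩ := B.isBlockIdempotent.exists_mul_eq_of_sum_eq (k := k) T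
    (fun y => B.idem.coeff y • relativeTrace (Subgroup.centralizer {y} ⊓ D) (a * δ y))
    (fun y _ => (Subalgebra.center k _).smul_mem (relativeTrace_mem_center (hfix y)) _) hsum
  refine ⟨y, fun h0 => B.isBlockIdempotent.ne_zero ?_, le_trans (hmin ?_ inf_le_right) inf_le_left⟩
  · rw [← hyw, h0, zero_smul, zero_mul]
  · refine ⟨B.idem.coeff y • (a * δ y * w), fun q hq => ?_, ?_⟩
    · rw [mul_smul_comm, smul_mul_assoc, ← mul_assoc, hfix y q hq, mul_assoc (a * δ y),
        (mem_center_iff_forall_of.1 hw q).eq]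
      simp only [mul_assoc]
    · rw [relativeTrace_smul, ← relativeTrace_mul _ hw, ← smul_mul_assoc]
      exact hyw

/-- Defect groups are `p`-groups. -/
theorem Block.exists_card_eq_pow_of_isDefectGroup (p : ℕ) [Fact p.Prime] [CharP k p]
    (B : Block k G) {D : Subgroup G}
    (hD : B.IsDefectGroup D) : ∃ n : ℕ, Nat.card D = p ^ n := by
  obtain ⟨⟨a, ha, htr⟩, hmin⟩ := hD
  obtain ⟨P⟩ : Nonempty (Sylow p D) := inferInstance
  let Q : Subgroup G := (P : Subgroup D).map D.subtype
  have hQD : Q ≤ D := Subgroup.map_subtype_le _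
  have := Fintype.ofFinite (D ⧸ Q.subgroupOf D)
  have hcard : Fintype.card (D ⧸ Q.subgroupOf D) = (P : Subgroup D).index := by
    rw [← Nat.card_eq_fintype_card, ← Subgroup.index]
    exact congrArg Subgroup.index (Subgroup.comap_map_eq_self_of_injective D.subtype_injective _)
  have hm : ((P : Subgroup D).index : k) ≠ 0 := by
    rw [Ne, CharP.cast_eq_zero_iff k p]
    exact P.not_dvd_index
  have hle : D ≤ Q := by
    -- Since `D` fixes `a`, the trace of `a` from a Sylow subgroup to `D` is the index times `a`,
    -- and the index is invertible in `k`.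
    refine hmin ⟨((P : Subgroup D).index : k)⁻¹ • a, fun q hq => ?_, ?_⟩ hQD
    · rw [mul_smul_comm, smul_mul_assoc, ha q (hQD hq)]
    · rw [relativeTrace_smul, relativeTrace_eq_relativeTrace_sum hQD fun q hq => ha q (hQD hq)]
      have h1 : ∀ d : D ⧸ Q.subgroupOf D, δ (d.out : D) * a * δ ((d.out : D) : G)⁻¹ = a := by
        intro d
        rw [ha _ (d.out : D).2, mul_assoc, ← map_mul, mul_inv_cancel, map_one, mul_one]
      rw [Finset.sum_congr rfl fun d _ => h1 d, Finset.sum_const, Finset.card_univ, hcard,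
        ← Nat.cast_smul_eq_nsmul k, relativeTrace_smul, smul_smul, inv_mul_cancel₀ hm, one_smul,
        htr]
  obtain ⟨n, hn⟩ := P.isPGroup'.exists_card_eq
  refine ⟨n, ?_⟩
  rw [le_antisymm hle hQD, ← hn]
  exact Nat.card_congr ((P : Subgroup D).equivMapOfInjective _ D.subtype_injective).symm.toEquiv

end Defect

/-! ### Decomposition numbers -/

section Decomposition

variable (p : ℕ) [Fact p.Prime] (k : Type u) [Field k]

theorem constantCoeff_surjective :
    Function.Surjective (WittVector.constantCoeff : WittVector p k →+* k) :=
  fun x => ⟨WittVector.teichmuller p x, WittVector.teichmuller_coeff_zero p x⟩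

variable [CharP k p]

variable {p k} in
-- The constant coefficient detects one factor `p` of a natural number, and `p` can be cancelled in
-- the Witt vectors; then induct.
theorem dvd_of_pow_dvd_cast {c d : ℕ} (h : (p : WittVector p k) ^ d ∣ (c : WittVector p k)) :
    p ^ d ∣ c := by
  induction d generalizing c with
  | zero => simp
  | succ d ih =>
    obtain ⟨x, hx⟩ := h
    have hpc : p ∣ c := by
      rw [← CharP.cast_eq_zero_iff k p]
      have := congrArg WittVector.constantCoeff hx
      rw [map_natCast, map_mul, map_pow, map_natCast, CharP.cast_eq_zero k p, pow_succ, mul_zero,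
        zero_mul] at this
      exact this
    obtain ⟨c, rfl⟩ := hpc
    rw [pow_succ']
    refine Nat.mul_dvd_mul_left p (ih ⟨x, ?_⟩)
    apply mul_left_cancel₀ (WittVector.p_nonzero p k)
    rw [← mul_assoc, ← pow_succ', ← hx]
    push_cast
    rfl

theorem charZero_wittVector : CharZero (WittVector p k) := by
  refine charZero_of_inj_zero fun n hn => ?_
  by_contra h0
  obtain ⟨d, hd⟩ := Nat.finiteMultiplicity_iff.2
    ⟨(Fact.out : p.Prime).ne_one, Nat.pos_of_ne_zero h0⟩
  exact hd (dvd_of_pow_dvd_cast (k := k) (hn ▸ dvd_zero _))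

theorem exists_injective_ringHom_wittVector :
    ∃ (L : Type u) (_ : Field L) (_ : IsAlgClosed L) (_ : CharZero L) (ι : WittVector p k →+* L),
      Function.Injective ι := by
  have := charZero_wittVector p k
  let ι : WittVector p k →+* AlgebraicClosure (FractionRing (WittVector p k)) :=
    (algebraMap (FractionRing (WittVector p k)) _).comp (algebraMap _ _)
  have hι : Function.Injective ι :=
    (FaithfulSMul.algebraMap_injective (FractionRing (WittVector p k)) _).comp
      (IsFractionRing.injective _ _)
  exact ⟨_, inferInstance, inferInstance, charZero_of_injective_ringHom hι, ι, hι⟩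

variable [IsAlgClosed k] (G : Type*) [Group G] [Fintype G]

/-- Idempotents of the group algebra have lifts to the ring of Witt vectors. The decomposition
numbers `m e i` of the projective modules they generate describe the dimensions of the spaces
`e A f`, and determine the class sums of the lifts. -/
theorem exists_decomposition :
    ∃ (N : ℕ) (m : MonoidAlgebra k G → Fin N → ℕ)
      (lift : MonoidAlgebra k G → MonoidAlgebra (WittVector p k) G),
      (∀ e f, IsIdempotentElem e → IsIdempotentElem f →
        peirceDim k e f = ∑ i, m e i * m f i) ∧
      (∀ e f, IsIdempotentElem e → IsIdempotentElem f → ∀ a b : ℕ,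
        (∀ i, a * m e i = b * m f i) →
        ∀ g, (a : WittVector p k) * classSum (lift e) g = b * classSum (lift f) g) ∧
      (∀ e, IsIdempotentElem e →
        MonoidAlgebra.mapRingHom G WittVector.constantCoeff (lift e) = e) ∧
      (∀ e, IsIdempotentElem e → (∀ g h : G, e.coeff (g * h * g⁻¹) = e.coeff h) →
        ∀ g h : G, (lift e).coeff (g * h * g⁻¹) = (lift e).coeff h) ∧
      (∀ e, IsIdempotentElem e →
        (peirceDim k e 1 : WittVector p k) = Nat.card G * (lift e).coeff 1) := by
  classical
  obtain ⟨L, _, _, _, ι, hι⟩ := exists_injective_ringHom_wittVector p k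
  obtain ⟨N, χ, hχ, hχ'⟩ := exists_characters L (MonoidAlgebra L G)
  -- The lift is made total, with the value `0` at elements that are not idempotent, so that one
  -- choice function serves all idempotents.
  have hlift : ∀ e : MonoidAlgebra k G, ∃ E : MonoidAlgebra (WittVector p k) G, IsIdempotentElem e →
      IsIdempotentElem E ∧ MonoidAlgebra.mapRingHom G WittVector.constantCoeff E = e ∧
      ((∀ g h : G, e.coeff (g * h * g⁻¹) = e.coeff h) →
        ∀ g h : G, E.coeff (g * h * g⁻¹) = E.coeff h) := by
    intro e
    by_cases he : IsIdempotentElem e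
    · obtain ⟨E, hE⟩ := exists_isIdempotentElem_map_eq (I := Ideal.span {(p : WittVector p k)})
        WittVector.constantCoeff (constantCoeff_surjective p k)
        (WittVector.ker_constantCoeff ..) he
      exact ⟨E, fun _ => hE⟩
    · exact ⟨0, fun h => absurd h he⟩
  choose lift hlift using hlift
  have hid : ∀ e, IsIdempotentElem e →
      IsIdempotentElem (MonoidAlgebra.mapRingHom G ι (lift e)) :=
    fun e he => (hlift e he).1.map (MonoidAlgebra.mapRingHom G ι)
  have hm : ∀ (e : MonoidAlgebra k G) (i : Fin N), ∃ m : ℕ, IsIdempotentElem e →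
      χ i (MonoidAlgebra.mapRingHom G ι (lift e)) = m := by
    intro e i
    by_cases he : IsIdempotentElem e
    · obtain ⟨m, hm⟩ := hχ' _ (hid e he) i
      exact ⟨m, fun _ => hm⟩
    · exact ⟨0, fun h => absurd h he⟩
  choose m hm using hm
  refine ⟨N, m, lift, fun e f he hf => ?_, fun e f he hf a b hab g => ?_,
    fun e he => (hlift e he).2.1, fun e he => (hlift e he).2.2, fun e he => ?_⟩
  -- The dimension of `e A f` equals that of its lift over `L`, which is the trace of a projection
  -- and so a sum of products of character values.
  · have h1 := peirceDim_mapRingHom_eq WittVector.constantCoeff ι hι (hlift e he).1 (hlift f hf).1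
    rw [(hlift e he).2.1, (hlift f hf).2.1] at h1
    have h2 := trace_sandwich (k := L) (hid e he) (hid f hf)
    rw [hχ, ← h1] at h2
    have h3 : (peirceDim k e f : L) = ((∑ i, m e i * m f i : ℕ) : L) := by
      rw [← h2]
      push_cast
      exact Finset.sum_congr rfl fun i _ => by rw [hm e i he, hm f i hf]
    exact_mod_cast h3
  -- All characters vanish at `x`, hence so does the trace of `z ↦ x * z * g⁻¹`, which is `|C(g)|`
  -- times the class sum of `x` at `g`.
  · let x : MonoidAlgebra (WittVector p k) G := (a : WittVector p k) • lift e - (b : WittVector p k) • lift f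
    have hx : ∀ i, χ i (MonoidAlgebra.mapRingHom G ι x) = 0 := by
      intro i
      have h1 : MonoidAlgebra.mapRingHom G ι x = (a : L) • MonoidAlgebra.mapRingHom G ι (lift e) -
          (b : L) • MonoidAlgebra.mapRingHom G ι (lift f) := by
        ext g
        simp only [x, MonoidAlgebra.coeff_mapRingHom, MonoidAlgebra.coeff_sub,
          MonoidAlgebra.coeff_smul, Finsupp.sub_apply, Finsupp.smul_apply, smul_eq_mul, map_sub,
          map_mul]
        rw [map_natCast ι a, map_natCast ι b]
      rw [h1, map_sub, map_smul, map_smul, hm e i he, hm f i hf, smul_eq_mul, smul_eq_mul,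
        sub_eq_zero]
      have h2 := congrArg (Nat.cast : ℕ → L) (hab i)
      rwa [Nat.cast_mul, Nat.cast_mul] at h2
    have htr := trace_sandwich_single (MonoidAlgebra.mapRingHom G ι x) g⁻¹
    rw [hχ, Finset.sum_eq_zero fun i _ => by rw [hx i, zero_mul], inv_inv,
      sum_conj_eq_card_mul_classSum, classSum_mapRingHom] at htr
    have hcard : (Nat.card (Subgroup.centralizer {g}) : L) ≠ 0 :=
      Nat.cast_ne_zero.2 Nat.card_pos.ne'
    have h0 : classSum x g = 0 := by
      apply hι
      rw [map_zero]
      exact (mul_eq_zero.1 htr.symm).resolve_left hcard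
    rw [← sub_eq_zero, ← h0]
    simp [classSum, x, Finset.mul_sum]
  -- With `f = 1`, the dimension is the trace of left multiplication by the lift, where only the
  -- coefficient at `1` contributes, once for each group element.
  · have h1 := peirceDim_mapRingHom_eq WittVector.constantCoeff ι hι (hlift e he).1
      IsIdempotentElem.one
    rw [(hlift e he).2.1, map_one, map_one] at h1
    have h2 := trace_sandwich (k := L) (hid e he) (IsIdempotentElem.one (M := MonoidAlgebra L G))
    rw [← h1, MonoidAlgebra.one_def, trace_sandwich_single] at h2
    apply hι
    rw [map_natCast ι, ← h2]
    simp

end Decomposition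

/-! ### The Cauchy-Schwarz inequality for Gram matrices -/

section Gram

/-- Lagrange's identity, with products ordered to match the Gram entries. -/
theorem sum_sq_sub_eq {ι : Type*} [Fintype ι] (a b : ι → ℤ) :
    ∑ x, ∑ y, (a x * b y - a y * b x) ^ 2 =
      2 * ((∑ x, b x * b x) * (∑ x, a x ^ 2) - ∑ x, ∑ y, a x * a y * (b y * b x)) := by
  have h : ∀ x y, (a x * b y - a y * b x) ^ 2 =
      a x ^ 2 * (b y * b y) + b x * b x * a y ^ 2 - 2 * (a x * a y * (b y * b x)) := by
    intro x y; ring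
  simp only [h, Finset.sum_sub_distrib, Finset.sum_add_distrib, ← Finset.mul_sum, ← Finset.sum_mul]
  ring

variable {ι κ : Type*} [Fintype ι] [Fintype κ] (n : ι → ℕ) (m : ι → κ → ℕ)

/-- Lagrange's identity in each coordinate `i`, summed over `i`: it exhibits the defect in the
Cauchy-Schwarz inequality as a sum of squares, which gives both the inequality and the case of
equality. -/
theorem sum_sq_sub_gram_eq :
    ∑ i, ∑ x, ∑ y, ((n x : ℤ) * m y i - n y * m x i) ^ 2 =
      2 * (((∑ x, ∑ i, m x i * m x i : ℕ) : ℤ) * (∑ x, n x ^ 2 : ℕ) -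
        (∑ x, ∑ y, n x * n y * ∑ i, m y i * m x i : ℕ)) := by
  rw [Finset.sum_congr rfl fun i _ => sum_sq_sub_eq (fun x => (n x : ℤ)) fun x => (m x i : ℤ),
    ← Finset.mul_sum, Finset.sum_sub_distrib, ← Finset.sum_mul]
  push_cast
  congr 3
  · rw [Finset.sum_comm]
  · rw [Finset.sum_comm]
    refine Finset.sum_congr rfl fun x _ => ?_
    rw [Finset.sum_comm]
    simp only [Finset.mul_sum]

theorem sum_gram_le : ∑ x, ∑ y, n x * n y * ∑ i, m y i * m x i ≤
    (∑ x, ∑ i, m x i * m x i) * ∑ x, n x ^ 2 := by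
  have h := sum_sq_sub_gram_eq n m
  have h0 : 0 ≤ ∑ i, ∑ x, ∑ y, ((n x : ℤ) * m y i - n y * m x i) ^ 2 :=
    Finset.sum_nonneg fun i _ => Finset.sum_nonneg fun x _ => Finset.sum_nonneg fun y _ =>
      sq_nonneg _
  rw [h] at h0
  zify
  push_cast at h0
  linarith

theorem mul_eq_mul_of_sum_gram_eq (heq : ∑ x, ∑ y, n x * n y * ∑ i, m y i * m x i =
    (∑ x, ∑ i, m x i * m x i) * ∑ x, n x ^ 2) (x y : ι) (i : κ) :
    n x * m y i = n y * m x i := by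
  have h := sum_sq_sub_gram_eq n m
  rw [heq, Nat.cast_mul, sub_self, mul_zero, Finset.sum_eq_zero_iff_of_nonneg fun i _ =>
    Finset.sum_nonneg fun x _ => Finset.sum_nonneg fun y _ => sq_nonneg _] at h
  have h1 := h i (Finset.mem_univ i)
  rw [Finset.sum_eq_zero_iff_of_nonneg fun x _ => Finset.sum_nonneg fun y _ => sq_nonneg _] at h1
  have h2 := h1 x (Finset.mem_univ x)
  rw [Finset.sum_eq_zero_iff_of_nonneg fun y _ => sq_nonneg _] at h2
  have h3 := h2 y (Finset.mem_univ y)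
  rw [sq_eq_zero_iff, sub_eq_zero] at h3
  exact_mod_cast h3

end Gram

/-! ### The Cartan matrix and the dimension of a block -/

section Cartan

theorem idemDim_span_singleton {k A : Type*} [Field k] [Ring A] [Algebra k A] (e f : A) :
    idemDim k e (Submodule.span A {f}) = peirceDim k e f := by
  have h : (LinearMap.range (Algebra.lsmul k k (Submodule.span A {f}) e)).map
      ((Submodule.span A {f}).subtype.restrictScalars k) = LinearMap.range (sandwich k e f) := by
    ext x
    constructor
    · rintro ⟨_, ⟨⟨y, hy⟩, rfl⟩, rfl⟩
      obtain ⟨a, rfl⟩ := Submodule.mem_span_singleton.1 hy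
      exact ⟨a, rfl⟩
    · rintro ⟨a, rfl⟩
      exact ⟨_, ⟨⟨a * f, Submodule.mem_span_singleton.2 ⟨a, rfl⟩⟩, rfl⟩, rfl⟩
  rw [peirceDim, ← h]
  exact (Submodule.equivMapOfInjective ((Submodule.span A {f}).subtype.restrictScalars k)
    (Submodule.span A {f}).subtype_injective
    (LinearMap.range (Algebra.lsmul k k (Submodule.span A {f}) e))).finrank_eq

variable {p : ℕ} {k : Type u} {G : Type v} [Field k] [Group G] (B : Block k G)

theorem Block.Contains.congr {V W : Type*} [AddCommGroup V]
    [Module (MonoidAlgebra k G) V] [AddCommGroup W] [Module (MonoidAlgebra k G) W]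
    {B : Block k G} (h : B.Contains V) (α : V ≃ₗ[MonoidAlgebra k G] W) : B.Contains W := by
  intro x
  obtain ⟨y, rfl⟩ := α.surjective x
  rw [← map_smul, h y]

/-- The generator of a principal indecomposable module of `B` as the identity of `B` acts on it. -/
theorem Block.idem_mul_eq {e : MonoidAlgebra k G} (he : IsPrimitiveIdempotent e) {V : Type*}
    [AddCommGroup V] [Module k V] [Module (MonoidAlgebra k G) V]
    [IsScalarTower k (MonoidAlgebra k G) V] [FiniteDimensional k V]
    (hV : B.Contains V) (h : idemDim k e V ≠ 0) : e * B.idem = e := by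
  have hcomm : e * B.idem = B.idem * e :=
    Semigroup.mem_center_iff.1 B.isBlockIdempotent.central e
  have hB := B.isBlockIdempotent.idem.eq
  have hidem : e * B.idem * (e * B.idem) = e * B.idem := by
    rw [mul_assoc, ← mul_assoc B.idem, ← hcomm, mul_assoc e, hB, ← mul_assoc, he.idem.eq]
  have h1 : e * (e * B.idem) = e * B.idem := by rw [← mul_assoc, he.idem.eq]
  have h2 : e * B.idem * e = e * B.idem := by
    rw [mul_assoc, ← hcomm, h1]
  -- Primitivity leaves `e * B.idem = 0` or `e * B.idem = e`; in the first case `e` would kill `V`.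
  rcases he.indecomposable (e * B.idem) (e - e * B.idem) hidem
    (by simp only [IsIdempotentElem, mul_sub, sub_mul, he.idem.eq, h1, h2, hidem]; abel)
    (by rw [mul_sub, h2, hidem, sub_self]) (by rw [sub_mul, h1, hidem, sub_self])
    (by abel) with h3 | h3
  · refine absurd (idemDim_eq_zero_iff.2 fun x => ?_) h
    rw [← hV x, smul_smul, h3, zero_smul]
  · exact (sub_eq_zero.1 h3).symm

variable [Finite G] {θ : RootLift p k G}

theorem Block.contains_simpleModule (φ : B.Irr θ) : B.Contains (B.SimpleModule φ) :=
  φ.2.choose_spec.2.1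

theorem Block.brauerCharacter_simpleModule (φ : B.Irr θ) :
    brauerCharacter θ (B.SimpleModule φ) = φ :=
  φ.2.choose_spec.2.2

theorem Block.isPrincipalIndecomposable_pim (φ : B.Irr θ) :
    IsPrincipalIndecomposable (B.pim φ) (B.SimpleModule φ) :=
  (exists_isPrincipalIndecomposable (R := MonoidAlgebra k G) (B.SimpleModule φ)).choose_spec

theorem Block.eq_of_linearEquiv {φ ψ : B.Irr θ}
    (h : Nonempty (B.SimpleModule φ ≃ₗ[MonoidAlgebra k G] B.SimpleModule ψ)) : φ = ψ := by
  obtain ⟨α⟩ := h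
  exact Subtype.ext (by
    rw [← B.brauerCharacter_simpleModule φ, ← B.brauerCharacter_simpleModule ψ,
      brauerCharacter_congr θ α])

variable (θ) in
/-- Primitive idempotents `e φ` for the principal indecomposable modules of `B`. -/
theorem Block.exists_primitive [IsAlgClosed k] : ∃ e : B.Irr θ → MonoidAlgebra k G,
    (∀ φ, IsPrimitiveIdempotent (e φ)) ∧ (∀ φ, B.pim φ = Submodule.span _ {e φ}) ∧
    (∀ φ, idemDim k (e φ) (B.SimpleModule φ) = 1) ∧
    (∀ φ ψ, φ ≠ ψ → idemDim k (e φ) (B.SimpleModule ψ) = 0) ∧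
    ∀ φ, e φ * B.idem = e φ := by
  choose e he hP h0 using fun φ : B.Irr θ =>
    exists_span_eq_and_idemDim_ne_zero (k := k) (B.isPrincipalIndecomposable_pim φ)
  refine ⟨e, he, hP, fun φ => (he φ).idemDim_eq_one (h0 φ), fun φ ψ hne => ?_,
    fun φ => B.idem_mul_eq (he φ) (B.contains_simpleModule φ) (h0 φ)⟩
  by_contra h
  exact hne (B.eq_of_linearEquiv ((he φ).nonempty_linearEquiv h (h0 φ)))

variable {B} {e : B.Irr θ → MonoidAlgebra k G}

/-- The entries of the Cartan matrix are the dimensions of the spaces `e A f`. -/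
theorem Block.cartanMatrix_apply (he : ∀ φ, IsPrimitiveIdempotent (e φ))
    (hP : ∀ φ, B.pim φ = Submodule.span _ {e φ})
    (h1 : ∀ φ, idemDim k (e φ) (B.SimpleModule φ) = 1) (φ ψ : B.Irr θ) :
    B.cartanMatrix θ φ ψ = peirceDim k (e φ) (e ψ) := by
  have := finiteDimensional_coe_submodule (k := k) (B.pim ψ)
  have h0 : idemDim k (e φ) (B.SimpleModule φ) ≠ 0 := by rw [h1]; exact one_ne_zero
  have h2 : B.cartanMatrix θ φ ψ = idemDim k (e φ) (B.pim ψ) := by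
    refine compositionMultiplicity_eq_idemDim (he φ).idem ?_ ?_
    · intro T _ _ _ _ _ _ ⟨α⟩
      rw [idemDim_congr _ α, h1]
    · intro T _ _ _ _ _ _ hT
      by_contra h
      exact hT ((he φ).nonempty_linearEquiv h0 h)
  rw [h2, hP, idemDim_span_singleton]

variable [Fact p.Prime] [CharP k p] [IsAlgClosed k]

/-- Every simple module in `B` is one of the chosen ones. -/
theorem Block.exists_linearEquiv_simpleModule (B : Block k G) (hθ : Function.Injective θ) {V : Type*}
    [AddCommGroup V] [Module (MonoidAlgebra k G) V] [IsSimpleModule (MonoidAlgebra k G) V]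
    (hV : B.Contains V) :
    ∃ φ : B.Irr θ, Nonempty (V ≃ₗ[MonoidAlgebra k G] B.SimpleModule φ) := by
  have := IsSimpleModule.nontrivial (MonoidAlgebra k G) V
  obtain ⟨x, hx⟩ := exists_ne (0 : V)
  let α := (LinearMap.toSpanSingleton (MonoidAlgebra k G) V x).quotKerEquivOfSurjective
    (IsSimpleModule.toSpanSingleton_surjective _ hx)
  have hsimple := IsSimpleModule.congr α
  -- The module chosen for `φ` may differ from this quotient, but it has the same Brauer character,
  -- which determines it up to isomorphism since `θ` is injective.
  let φ : B.Irr θ := ⟨_, _, hsimple, hV.congr α.symm, rfl⟩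
  obtain ⟨β⟩ := nonempty_linearEquiv_of_brauerCharacter_eq θ hθ
    (B.brauerCharacter_simpleModule φ).symm
  exact ⟨φ, ⟨α.symm.trans β⟩⟩

/-- The dimension of a module in `B` in terms of its composition multiplicities. -/
theorem Block.Contains.finrank_eq (hθ : Function.Injective θ)
    (hid : ∀ φ, IsIdempotentElem (e φ))
    (h1 : ∀ φ, idemDim k (e φ) (B.SimpleModule φ) = 1)
    (h0 : ∀ φ ψ, φ ≠ ψ → idemDim k (e φ) (B.SimpleModule ψ) = 0)
    {M : Type*} [AddCommGroup M] [Module k M] [Module (MonoidAlgebra k G) M]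
    [IsScalarTower k (MonoidAlgebra k G) M] [FiniteDimensional k M] (hM : B.Contains M) :
    Module.finrank k M =
      ∑ φ : B.Irr θ, Module.finrank k (B.SimpleModule φ) * idemDim k (e φ) M := by
  have : IsNoetherian (MonoidAlgebra k G) M := isNoetherian_of_tower k inferInstance
  have : IsArtinian (MonoidAlgebra k G) M := isArtinian_of_tower k inferInstance
  obtain ⟨s, hs0, hs1⟩ :=
    exists_compositionSeries_of_isNoetherian_isArtinian (MonoidAlgebra k G) M
  -- Both sides are additive along a composition series, so it suffices to compare them on one
  -- simple factor.
  rw [← idemDim_one (k := k) (A := MonoidAlgebra k G), idemDim_eq_sum IsIdempotentElem.one s hs0 hs1]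
  refine Eq.trans ?_ (Finset.sum_comm.trans (Finset.sum_congr rfl fun φ _ =>
    (Finset.mul_sum ..).symm.trans
      (congrArg (Module.finrank k (B.SimpleModule φ) * ·) (idemDim_eq_sum (hid φ) s hs0 hs1).symm)))
  refine Finset.sum_congr rfl fun i _ => ?_
  have := isSimpleModule_factor s i
  have hF : B.Contains (↥(s i.succ) ⧸ (s i.castSucc).submoduleOf (s i.succ)) := by
    intro x
    obtain ⟨⟨y, hy⟩, rfl⟩ := Submodule.Quotient.mk_surjective _ x
    rw [← Submodule.Quotient.mk_smul]
    exact congrArg _ (Subtype.ext (hM y))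
  obtain ⟨φ, ⟨α⟩⟩ := B.exists_linearEquiv_simpleModule hθ hF
  rw [idemDim_congr _ α, idemDim_one, Finset.sum_eq_single φ]
  · rw [idemDim_congr _ α, h1, mul_one]
  · intro ψ _ hψ
    rw [idemDim_congr _ α, h0 ψ φ hψ, mul_zero]
  · exact fun h => absurd (Finset.mem_univ φ) h

end Cartan

/-! ### The dimension of a block and the trace of its Cartan matrix -/

section Dimension

variable {p : ℕ} {k : Type u} {G : Type v} [Field k] [Group G] (B : Block k G)

theorem Block.idem_mul_comm (x : MonoidAlgebra k G) : B.idem * x = x * B.idem :=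
  (Semigroup.mem_center_iff.1 B.isBlockIdempotent.central x).symm

theorem Block.dim_eq_peirceDim : B.dim = peirceDim k 1 B.idem := by
  have h : LinearMap.mulLeft k B.idem = sandwich k 1 B.idem := by
    refine LinearMap.ext fun x => ?_
    rw [LinearMap.mulLeft_apply, sandwich_apply, one_mul, B.idem_mul_comm]
  rw [Block.dim, Block.ideal, h, peirceDim]

theorem Block.peirceDim_idem {f : MonoidAlgebra k G} (hf : f * B.idem = f) :
    peirceDim k f B.idem = peirceDim k f 1 := by
  have h : sandwich k f B.idem = sandwich k f 1 := by
    refine LinearMap.ext fun x => ?_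
    rw [sandwich_apply, sandwich_apply, mul_one, ← B.idem_mul_comm, ← mul_assoc, hf]
  rw [peirceDim, h, peirceDim]

theorem Block.contains_span_singleton {f : MonoidAlgebra k G} (hf : f * B.idem = f) :
    B.Contains (Submodule.span (MonoidAlgebra k G) {f}) := by
  rintro ⟨x, hx⟩
  obtain ⟨a, rfl⟩ := Submodule.mem_span_singleton.1 hx
  refine Subtype.ext ?_
  change B.idem * (a * f) = a * f
  rw [B.idem_mul_comm, mul_assoc, hf]

variable [Finite G] {θ : RootLift p k G} {B} {e : B.Irr θ → MonoidAlgebra k G}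
theorem Block.finrank_simpleModule_pos (B : Block k G) (φ : B.Irr θ) :
    0 < Module.finrank k (B.SimpleModule φ) := by
  have := IsSimpleModule.nontrivial (MonoidAlgebra k G) (B.SimpleModule φ)
  exact Module.finrank_pos

variable [Fact p.Prime] [CharP k p] [IsAlgClosed k]

theorem Block.peirceDim_one_eq_sum (hθ : Function.Injective θ)
    (hid : ∀ φ, IsIdempotentElem (e φ))
    (h1 : ∀ φ, idemDim k (e φ) (B.SimpleModule φ) = 1)
    (h0 : ∀ φ ψ, φ ≠ ψ → idemDim k (e φ) (B.SimpleModule ψ) = 0)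
    {f : MonoidAlgebra k G} (hf : f * B.idem = f) :
    peirceDim k 1 f =
      ∑ φ : B.Irr θ, Module.finrank k (B.SimpleModule φ) * peirceDim k (e φ) f := by
  have := finiteDimensional_coe_submodule (k := k) (Submodule.span (MonoidAlgebra k G) {f})
  rw [← idemDim_span_singleton, idemDim_one,
    (B.contains_span_singleton hf).finrank_eq hθ hid h1 h0]
  exact Finset.sum_congr rfl fun φ _ => by rw [idemDim_span_singleton]

/-- Counting composition factors of `A b`, for the block idempotent `b`, gives the spaces `(e φ) A`;
by `hsymm` these have the dimensions of the modules `A (e φ)`, whose factors are counted again. -/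
theorem Block.dim_eq_sum (hθ : Function.Injective θ)
    (hid : ∀ φ, IsIdempotentElem (e φ))
    (h1 : ∀ φ, idemDim k (e φ) (B.SimpleModule φ) = 1)
    (h0 : ∀ φ ψ, φ ≠ ψ → idemDim k (e φ) (B.SimpleModule ψ) = 0)
    (hB : ∀ φ, e φ * B.idem = e φ)
    (hsymm : ∀ a b : MonoidAlgebra k G, IsIdempotentElem a → IsIdempotentElem b →
      peirceDim k a b = peirceDim k b a) :
    B.dim = ∑ φ : B.Irr θ, ∑ ψ : B.Irr θ, Module.finrank k (B.SimpleModule φ) *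
      Module.finrank k (B.SimpleModule ψ) * peirceDim k (e ψ) (e φ) := by
  rw [B.dim_eq_peirceDim, Block.peirceDim_one_eq_sum hθ hid h1 h0 B.isBlockIdempotent.idem]
  refine Finset.sum_congr rfl fun φ _ => ?_
  rw [B.peirceDim_idem (hB φ), hsymm _ _ (hid φ) IsIdempotentElem.one,
    Block.peirceDim_one_eq_sum hθ hid h1 h0 (hB φ), Finset.mul_sum]
  exact Finset.sum_congr rfl fun ψ _ => (mul_assoc _ _ _).symm

end Dimension

/-! ### Class sums, traces and the order of a defect group -/

section Traces

variable {p : ℕ} {k : Type u} {G : Type v} [Field k] [Group G] [Fintype G]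

/-- Elements with the same class sums have the same trace on every module. -/
theorem natCast_mul_trace_eq {V : Type*} [AddCommGroup V] [Module k V]
    [Module (MonoidAlgebra k G) V] [IsScalarTower k (MonoidAlgebra k G) V]
    {x y : MonoidAlgebra k G} {a b : ℕ}
    (h : ∀ g, (a : k) * classSum x g = b * classSum y g) :
    (a : k) * LinearMap.trace k V (Algebra.lsmul k k V x) =
      b * LinearMap.trace k V (Algebra.lsmul k k V y) := by
  have h1 := trace_eq_zero_of_classSum_eq_zero (V := V) ((a : k) • x - (b : k) • y) fun g => by
    have := h g
    simp only [classSum, Finset.mul_sum] at this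
    simp only [classSum, MonoidAlgebra.coeff_sub, MonoidAlgebra.coeff_smul, Finsupp.sub_apply,
      Finsupp.smul_apply, smul_eq_mul, Finset.sum_sub_distrib, this, sub_self]
  rw [map_sub, map_smul, map_smul, map_sub, map_smul, map_smul, sub_eq_zero] at h1
  exact h1

/-- The class sums of idempotents that single out different simple modules are not
proportional. -/
theorem false_of_natCast_mul_classSum_eq (p : ℕ) [Fact p.Prime] [CharP k p]
    {x y : MonoidAlgebra k G} {V W : Type*}
    [AddCommGroup V] [Module k V] [Module (MonoidAlgebra k G) V]
    [IsScalarTower k (MonoidAlgebra k G) V] [FiniteDimensional k V]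
    [AddCommGroup W] [Module k W] [Module (MonoidAlgebra k G) W]
    [IsScalarTower k (MonoidAlgebra k G) W] [FiniteDimensional k W]
    (hx : IsIdempotentElem x) (hy : IsIdempotentElem y)
    (hxV : idemDim k x V = 1) (hyV : idemDim k y V = 0)
    (hxW : idemDim k x W = 0) (hyW : idemDim k y W = 1) {a b : ℕ} (hab : a.Coprime b)
    (h : ∀ g, (a : k) * classSum x g = b * classSum y g) : False := by
  -- The traces on `V` give `a = 0` in `k` and those on `W` give `b = 0`, so `p` divides both
  -- coprime numbers.
  have hV := natCast_mul_trace_eq (V := V) h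
  have hW := natCast_mul_trace_eq (V := W) h
  rw [trace_lsmul_of_isIdempotentElem hx, trace_lsmul_of_isIdempotentElem hy, hxV, hyV,
    Nat.cast_one, Nat.cast_zero, mul_one, mul_zero, CharP.cast_eq_zero_iff k p] at hV
  rw [trace_lsmul_of_isIdempotentElem hx, trace_lsmul_of_isIdempotentElem hy, hxW, hyW,
    Nat.cast_one, Nat.cast_zero, mul_one, mul_zero, eq_comm, CharP.cast_eq_zero_iff k p] at hW
  exact (Fact.out : p.Prime).not_dvd_one (hab ▸ Nat.dvd_gcd hV hW)

/-- If the class sums of a lift of the block idempotent are multiples of those of `F`, then the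
order of a defect group of the block divides `c`, where `n * c = |G| F(1)`. -/
theorem Block.card_dvd_of_proportional [Fact p.Prime] [CharP k p] (B : Block k G)
    {E F : MonoidAlgebra (WittVector p k) G}
    (hE : MonoidAlgebra.mapRingHom G WittVector.constantCoeff E = B.idem)
    (hEconj : ∀ g h : G, E.coeff (g * h * g⁻¹) = E.coeff h) {n c : ℕ} (hn : 0 < n)
    (hcl : ∀ g, classSum E g = (n : WittVector p k) * classSum F g)
    (hc : ((n * c : ℕ) : WittVector p k) = Nat.card G * F.coeff 1)
    {D : Subgroup G} (hD : B.IsDefectGroup D) : Nat.card D ∣ c := by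
  have := charZero_wittVector p k
  obtain ⟨y, hy, hDy⟩ := B.exists_coeff_ne_zero_of_isDefectGroup hD
  obtain ⟨d, hd⟩ := B.exists_card_eq_pow_of_isDefectGroup p hD
  have hu : IsUnit (E.coeff y) := by
    refine WittVector.isUnit_of_coeff_zero_ne_zero _ ?_
    rw [← hE] at hy
    simpa using hy
  have h1 := sum_conj_eq_card_mul_classSum E y
  simp only [hEconj, Finset.sum_const, Finset.card_univ, nsmul_eq_mul, hcl] at h1
  rw [← Nat.card_eq_fintype_card] at h1
  -- Invariance of `E` gives `|G| * E(y) = |C(y)| * n * classSum F y`. Multiplying by `F(1)` brings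
  -- in `n * c = |G| * F(1)`; after cancelling `n`, the unit `E(y)` leaves `|C(y)|` dividing `c`.
  have h2 : (n : WittVector p k) * (c * E.coeff y) =
      n * (Nat.card (Subgroup.centralizer {y}) * (classSum F y * F.coeff 1)) := by
    calc (n : WittVector p k) * (c * E.coeff y) = ((n * c : ℕ) : WittVector p k) * E.coeff y := by
          push_cast; ring
      _ = Nat.card G * E.coeff y * F.coeff 1 := by rw [hc]; ring
      _ = _ := by rw [h1]; ring
  have h3 := mul_left_cancel₀ (Nat.cast_ne_zero.2 hn.ne') h2
  have h4 : (Nat.card (Subgroup.centralizer {y}) : WittVector p k) ∣ c :=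
    (hu.dvd_mul_right).1 ⟨_, h3⟩
  have h5 : (p : WittVector p k) ^ d ∣ c := by
    refine dvd_trans ?_ h4
    rw [← Nat.cast_pow, ← hd]
    exact Nat.cast_dvd_cast (Subgroup.card_dvd_of_le hDy)
  rw [hd]
  exact dvd_of_pow_dvd_cast h5

end Traces

/-! ### The inequalities in terms of natural numbers -/

section Main

variable {p : ℕ} [Fact p.Prime] {k : Type u} [Field k] [IsAlgClosed k] [CharP k p]
  {G : Type v} [Group G] [Finite G] {θ : RootLift p k G} (B : Block k G)

theorem Block.dim_ne_zero : B.dim ≠ 0 := by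
  rw [B.dim_eq_peirceDim]
  intro h
  have h2 : sandwich k 1 B.idem = 0 := by
    rwa [peirceDim, Submodule.finrank_eq_zero, LinearMap.range_eq_bot] at h
  have := LinearMap.congr_fun h2 1
  rw [sandwich_apply, one_mul, one_mul] at this
  exact B.isBlockIdempotent.ne_zero this

variable (θ) in
/-- The bound for the dimension of a block, with the case of equality, and the bound for the order
of a defect group of a block with one simple module. -/
theorem Block.dim_le_and_eq_iff (hθ : Function.Injective θ) :
    0 < B.l θ ∧ 0 < (B.cartanMatrix θ).trace ∧
    B.dim ≤ (B.cartanMatrix θ).trace * ∑ φ : B.Irr θ, Module.finrank k (B.SimpleModule φ) ^ 2 ∧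
    (B.dim = (B.cartanMatrix θ).trace * ∑ φ : B.Irr θ, Module.finrank k (B.SimpleModule φ) ^ 2 ↔
      B.l θ = 1) ∧
    ∀ D : Subgroup G, B.IsDefectGroup D → B.l θ = 1 →
      Nat.card D ≤ (B.cartanMatrix θ).trace := by
  have := Fintype.ofFinite G
  obtain ⟨e, he, hP, h1, h0, hB⟩ := B.exists_primitive θ
  obtain ⟨N, m, lift, hm, hcl, hlift, hconj, hone⟩ := exists_decomposition p k G
  have hid : ∀ φ, IsIdempotentElem (e φ) := fun φ => (he φ).idem
  have hidB := B.isBlockIdempotent.idem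
  have hsymm : ∀ a b : MonoidAlgebra k G, IsIdempotentElem a → IsIdempotentElem b →
      peirceDim k a b = peirceDim k b a := fun a b ha hb => by
    rw [hm a b ha hb, hm b a hb ha]
    exact Finset.sum_congr rfl fun i _ => mul_comm _ _
  have hdim : B.dim = ∑ φ : B.Irr θ, ∑ ψ : B.Irr θ, Module.finrank k (B.SimpleModule φ) *
      Module.finrank k (B.SimpleModule ψ) * ∑ i, m (e ψ) i * m (e φ) i := by
    rw [Block.dim_eq_sum hθ hid h1 h0 hB hsymm]
    exact Finset.sum_congr rfl fun φ _ => Finset.sum_congr rfl fun ψ _ => by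
      rw [hm _ _ (hid ψ) (hid φ)]
  have htr : (B.cartanMatrix θ).trace = ∑ φ : B.Irr θ, ∑ i, m (e φ) i * m (e φ) i := by
    refine Finset.sum_congr rfl fun φ _ => ?_
    rw [Matrix.diag_apply, Block.cartanMatrix_apply he hP h1, hm _ _ (hid φ) (hid φ)]
  have hle := sum_gram_le (fun φ : B.Irr θ => Module.finrank k (B.SimpleModule φ))
    fun φ => m (e φ)
  have heq := mul_eq_mul_of_sum_gram_eq (fun φ : B.Irr θ => Module.finrank k (B.SimpleModule φ))
    fun φ => m (e φ)
  rw [← hdim, ← htr] at hle heq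
  have hl : 0 < B.l θ := by
    rw [Block.l, Fintype.card_pos_iff]
    by_contra h
    rw [not_nonempty_iff] at h
    exact B.dim_ne_zero (hdim.trans (Fintype.sum_empty _))
  have htr0 : 0 < (B.cartanMatrix θ).trace := by
    refine Nat.pos_of_ne_zero fun h => B.dim_ne_zero ?_
    rw [h, zero_mul] at hle
    exact Nat.le_zero.1 hle
  refine ⟨hl, htr0, hle, ⟨fun h => ?_, fun h => ?_⟩, fun D hD h => ?_⟩
  · refine le_antisymm (Fintype.card_le_one_iff.2 fun φ ψ => ?_) hl
    by_contra hne
    set a := Module.finrank k (B.SimpleModule ψ)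
    set b := Module.finrank k (B.SimpleModule φ)
    have hapos : 0 < a := B.finrank_simpleModule_pos ψ
    have hgpos : 0 < a.gcd b := Nat.gcd_pos_of_pos_left _ hapos
    -- The common divisor has to be removed before reduction: if `p` divided both factors, the
    -- relation in `k` would be empty.
    have hprop : ∀ i, a / a.gcd b * m (e φ) i = b / a.gcd b * m (e ψ) i := by
      intro i
      refine Nat.eq_of_mul_eq_mul_left hgpos ?_
      rw [← mul_assoc, ← mul_assoc, Nat.mul_div_cancel' (Nat.gcd_dvd_left a b),
        Nat.mul_div_cancel' (Nat.gcd_dvd_right a b)]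
      exact heq h ψ φ i
    refine false_of_natCast_mul_classSum_eq p (hid φ) (hid ψ) (h1 φ) (h0 ψ φ (Ne.symm hne))
      (h0 φ ψ hne) (h1 ψ) (Nat.coprime_div_gcd_div_gcd hgpos) fun g => ?_
    have h2 := congrArg WittVector.constantCoeff (hcl _ _ (hid φ) (hid ψ) _ _ hprop g)
    rwa [map_mul, map_mul, ← classSum_mapRingHom, ← classSum_mapRingHom, hlift _ (hid φ),
      hlift _ (hid ψ), map_natCast, map_natCast] at h2
  · obtain ⟨φ, hφ⟩ := Fintype.card_eq_one_iff.1 h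
    have hs : ∀ f : B.Irr θ → ℕ, ∑ x, f x = f φ := fun f =>
      Fintype.sum_eq_single φ fun x hx => absurd (hφ x) hx
    rw [hdim, htr, hs, hs, hs, hs]
    ring
  · obtain ⟨φ, hφ⟩ := Fintype.card_eq_one_iff.1 h
    have hs : ∀ f : B.Irr θ → ℕ, ∑ x, f x = f φ := fun f =>
      Fintype.sum_eq_single φ fun x hx => absurd (hφ x) hx
    set n := Module.finrank k (B.SimpleModule φ)
    set c := (B.cartanMatrix θ).trace
    -- With `w` the vector of `e φ` and `u` that of the block idempotent, the inner products are
    -- `w·w = c`, `w·u = n * c` and `u·u = n * n * c`. Hence `u - n * w` has norm zero and `u = n *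
    -- w`.
    have hww : ∑ i, m (e φ) i * m (e φ) i = c := by
      rw [htr, hs]
    have hnc : peirceDim k (e φ) 1 = n * c := by
      rw [hsymm _ _ (hid φ) IsIdempotentElem.one,
        Block.peirceDim_one_eq_sum hθ hid h1 h0 (hB φ), hs,
        ← hww, ← hm _ _ (hid φ) (hid φ)]
    have huw : ∑ i, m (e φ) i * m B.idem i = n * c := by
      rw [← hm _ _ (hid φ) hidB, B.peirceDim_idem (hB φ), hnc]
    have huu : ∑ i, m B.idem i * m B.idem i = n * (n * c) := by
      rw [← hm _ _ hidB hidB, B.peirceDim_idem hidB, hsymm _ _ hidB IsIdempotentElem.one,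
        Block.peirceDim_one_eq_sum hθ hid h1 h0 hidB, hs,
        ← huw, ← hm _ _ (hid φ) hidB]
    have hzero : ∑ i, ((m B.idem i : ℤ) - n * m (e φ) i) ^ 2 = 0 := by
      have h2 : ∀ i, ((m B.idem i : ℤ) - n * m (e φ) i) ^ 2 = ((m B.idem i * m B.idem i : ℕ) : ℤ) -
          2 * n * (m (e φ) i * m B.idem i : ℕ) + n ^ 2 * (m (e φ) i * m (e φ) i : ℕ) := by
        intro i
        push_cast
        ring
      simp only [h2, Finset.sum_add_distrib, Finset.sum_sub_distrib, ← Finset.mul_sum,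
        ← Nat.cast_sum, hww, huw, huu]
      push_cast
      ring
    have hprop : ∀ i, 1 * m B.idem i = n * m (e φ) i := by
      intro i
      have h2 := (Finset.sum_eq_zero_iff_of_nonneg fun i _ => sq_nonneg _).1 hzero i
        (Finset.mem_univ i)
      rw [sq_eq_zero_iff, sub_eq_zero] at h2
      rw [one_mul]
      exact_mod_cast h2
    refine Nat.le_of_dvd htr0 (B.card_dvd_of_proportional (F := lift (e φ)) (hlift _ hidB) (hconj _ hidB ?_)
      (B.finrank_simpleModule_pos φ) (fun g => ?_) ?_ hD)
    · intro g y
      exact commute_single_iff.1 (mem_center_iff_forall_of.1 B.isBlockIdempotent.central g) y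
    · rw [← hcl _ _ hidB (hid φ) 1 n hprop g, Nat.cast_one, one_mul]
    · rw [← hnc]
      exact hone _ (hid φ)

end Main

end ModRep

end

/-! ### The inequalities over the complex numbers -/

theorem proposition2 {p : ℕ} [Fact p.Prime] {k : Type*} [Field k] [IsAlgClosed k] [CharP k p]
    {G : Type*} [Group G] [Finite G]
    -- an identification of the `p'`-roots of unity of `k` with complex roots of unity
    (θ : ModRep.RootLift p k G) (hθ : Function.Injective θ)
    (B : ModRep.Block k G) :
    ((B.dim : ℂ) / ((B.cartanMatrix θ).trace : ℂ) ≤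
        ∑ φ : B.Irr θ, (φ : ModRep.PRegular p G → ℂ) 1 ^ 2 ∧
      ((B.dim : ℂ) / ((B.cartanMatrix θ).trace : ℂ) =
        ∑ φ : B.Irr θ, (φ : ModRep.PRegular p G → ℂ) 1 ^ 2 ↔ B.l θ = 1)) ∧
    ∀ D : Subgroup G, B.IsDefectGroup D →
      (B.cartanMatrix θ).trace ≤ B.l θ * Nat.card D → B.LocalConjecture θ D := by
  obtain ⟨hl, htr, hle, heq, hcard⟩ := B.dim_le_and_eq_iff θ hθ
  have hsum : ∑ φ : B.Irr θ, (φ : ModRep.PRegular p G → ℂ) 1 ^ 2 =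
      ((∑ φ : B.Irr θ, Module.finrank k (B.SimpleModule φ) ^ 2 : ℕ) : ℂ) := by
    rw [Nat.cast_sum]
    refine Finset.sum_congr rfl fun φ _ => ?_
    have h := ModRep.brauerCharacter_one (V := B.SimpleModule φ) θ
    rw [B.brauerCharacter_simpleModule φ] at h
    rw [h, Nat.cast_pow]
  -- Degrees are dimensions, so both sides are built from natural numbers, and the positivity of the
  -- denominators moves the statements to `ℕ`.
  have hdivle : ∀ a b c : ℕ, 0 < b → ((a : ℂ) / b ≤ c ↔ a ≤ b * c) := by
    intro a b c hb
    have hb' : (0 : ℝ) < b := Nat.cast_pos.2 hb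
    have h : ((a : ℂ) / b ≤ c ↔ (a : ℝ) / b ≤ c) := by
      rw [← Complex.real_le_real]; push_cast; rfl
    rw [h, div_le_iff₀ hb', mul_comm]
    exact_mod_cast Iff.rfl
  have hdiveq : ∀ a b c : ℕ, 0 < b → ((a : ℂ) / b = c ↔ a = b * c) := by
    intro a b c hb
    rw [div_eq_iff (Nat.cast_ne_zero.2 hb.ne'), mul_comm]
    exact_mod_cast Iff.rfl
  rw [hsum, hdivle _ _ _ htr, hdiveq _ _ _ htr]
  refine ⟨⟨hle, heq⟩, fun D hD hDle => ?_⟩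
  have hDpos : 0 < B.l θ * Nat.card D := Nat.mul_pos hl Nat.card_pos
  rw [ModRep.Block.LocalConjecture, hsum, ← Nat.cast_mul, hdivle _ _ _ hDpos,
    hdiveq _ _ _ hDpos]
  -- Equality in the bound with `l(B) * |D|` squeezes `tr C` in between, so it forces equality in
  -- (a).
  refine ⟨hle.trans (Nat.mul_le_mul_right _ hDle), fun h => heq.1 (le_antisymm hle ?_),
    fun h => ?_⟩
  · rw [h]
    exact Nat.mul_le_mul_right _ hDle
  · have hc : (B.cartanMatrix θ).trace = B.l θ * Nat.card D := by
      refine le_antisymm hDle ?_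
      rw [h, one_mul]
      exact hcard D hD h
    rw [← hc]
    exact heq.2 h
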